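/- Agents of two types, hard-to-match ($H$) and easy-to-match ($E$), arrive to a market according to independent Poisson processes with rates $\lambda_H>0$ and $\lambda_E>0$. When an agent arrives, each possible directed compatibility edge between her and each waiting agent is present independently; an agent of type $H$ (respectively $E$) finds the item of any given other agent compatible with probability $p_H\in(0,1)$ (respectively $p_E\in(0,1]$). Under the policy BilateralMatch($E$), if the arriving agent forms at least one cycle of length two with waiting agents (each finds the item of the other compatible), then she and one such waiting agent exchange items and leave immediately; cycles with $E$ agents have priority over cycles with $H$ agents, and further ties are broken uniformly at random. If she forms no such cycle, she waits. The pair (number of waiting $H$ agents, number of waiting $E$ agents) is a continuous-time Markov chain. Let $w_H=w_H(\lambda_H,\lambda_E,p_H,p_E)$ be the average waiting time (departure time minus arrival time) of an $H$ agent who arrives to the market in steady state. **Theorem.** Fix $\lambda_H,\lambda_E>0$ and $p_E\in(0,1]$. For every $p_H\in(0,1)$ the chain has a unique steady-state distribution and $w_H$ is finite. Moreover: - If $\lambda_H<\lambda_E$, then $\lim_{p_H\to0^+}p_H\,w_H$ exists and $$\frac{\ln\left(\frac{\lambda_E}{\lambda_E-\lambda_H}\right)}{p_E\lambda_H}\;\le\;\lim_{p_H\to0^+}p_H\,w_H\;\le\;\frac{\ln\left(\frac{2\lambda_E}{\lambda_E-\lambda_H}\right)}{p_E\lambda_H}.$$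 - If $\lambda_H>\lambda_E$, then $$\lim_{p_H\to0^+}p_H^2\,w_H=\frac{\ln\left(\frac{2\lambda_H}{\lambda_H+\lambda_E}\right)}{\lambda_H}.$$ -/

import Mathlib

open Filter Topology

noncomputable section

/-- The two types of agents: hard-to-match (`H`) and easy-to-match (`E`). -/
inductive AgentType where
  | hard
  | easy
  deriving DecidableEq

/-- The parameters of the market: Poisson arrival rates of the two types, and the probabilities
with which an agent of each type finds the item of another agent compatible. -/
structure Market where
  lamH : ℝ
  lamE : ℝ
  pH : ℝ
  pE : ℝ

namespace Market

/-- Arrival rate of a type. -/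
def lam (M : Market) : AgentType → ℝ
  | .hard => M.lamH
  | .easy => M.lamE

/-- Probability that an agent of the given type finds the item of another agent compatible. -/
def p (M : Market) : AgentType → ℝ
  | .hard => M.pH
  | .easy => M.pE

/-- Total arrival rate. -/
def totalRate (M : Market) : ℝ := M.lamH + M.lamE

end Market

/-- The agents waiting in a market that holds `s.1` agents of type `H` and `s.2` of type `E`. -/
abbrev Agents (s : ℕ × ℕ) : Type := Fin s.1 ⊕ Fin s.2

/-- The type of a waiting agent. -/
def agentType {s : ℕ × ℕ} : Agents s → AgentType
  | .inl _ => .hard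
  | .inr _ => .easy

/-- Probability of the compatibility edges between an arriving agent of type `T` and the waiting
agents: `A` is the set of waiting agents that find the item of the arriving agent compatible, `B`
is the set of waiting agents whose item the arriving agent finds compatible. All directed edges
are independent, and the probability of an edge is given by the type of the receiving agent. -/
def edgeProb (M : Market) (s : ℕ × ℕ) (T : AgentType) (A B : Finset (Agents s)) : ℝ :=
  ∏ v : Agents s,
    ((if v ∈ A then M.p (agentType v) else 1 - M.p (agentType v)) *
      (if v ∈ B then M.p T else 1 - M.p T))

/-- The candidates for the exchange, when `C` is the set of the waiting agents that form a cycle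
of length two with the arriving agent and priority is given to `E` agents: the `E` agents in `C`
if there are any, and otherwise all agents in `C` (which are then of type `H`). -/
def candidates {s : ℕ × ℕ} (C : Finset (Agents s)) : Finset (Agents s) :=
  if (C.filter (fun v => agentType v = AgentType.easy)).Nonempty then
    C.filter (fun v => agentType v = AgentType.easy)
  else C

/-- Probability that the policy selects `o`, given the set `C` of waiting agents that form a cycle
of length two with the arriving agent. `none` means that nobody is matched, `some v` that the
arriving agent and `v` exchange items and leave; ties are broken uniformly at random. -/
def selectProb {s : ℕ × ℕ} (C : Finset (Agents s)) : Option (Agents s) → ℝ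
  | none => if C = ∅ then 1 else 0
  | some v => if v ∈ candidates C then 1 / ((candidates C).card : ℝ) else 0

/-- Probability that an agent of type `T` who arrives to the market `s` is matched with `v`
(outcome `some v`), or is not matched upon arrival (outcome `none`), under BilateralMatch(E). -/
def matchProb (M : Market) (s : ℕ × ℕ) (T : AgentType) (o : Option (Agents s)) : ℝ :=
  ∑ A : Finset (Agents s), ∑ B : Finset (Agents s),
    edgeProb M s T A B * selectProb (A ∩ B) o

/-- The numbers of waiting agents after the arrival of an agent of type `T` with outcome `o`. -/
def nextState (s : ℕ × ℕ) (T : AgentType) : Option (Agents s) → ℕ × ℕ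
  | none =>
    match T with
    | .hard => (s.1 + 1, s.2)
    | .easy => (s.1, s.2 + 1)
  | some (.inl _) => (s.1 - 1, s.2)
  | some (.inr _) => (s.1, s.2 - 1)

/-- Transition rates of the continuous-time Markov chain of the numbers of waiting `H` and `E`
agents under BilateralMatch(E). Every arrival changes the state, so diagonal entries vanish and
the rows sum to the total jump rate. -/
def transRate (M : Market) (s s' : ℕ × ℕ) : ℝ :=
  ∑ T ∈ ({AgentType.hard, AgentType.easy} : Finset AgentType),
    M.lam T * ∑ o : Option (Agents s),
      if nextState s T o = s' then matchProb M s T o else 0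

/-- `π` is a steady-state distribution of the chain: a probability distribution on the states
that satisfies the global balance equations (all jump rates are bounded). -/
structure IsSteadyState (M : Market) (π : ℕ × ℕ → ℝ) : Prop where
  nonneg : ∀ s, 0 ≤ π s
  hasSum_one : HasSum π 1
  balance : ∀ s', HasSum (fun s => π s * transRate M s s') (π s' * ∑' s, transRate M s' s)

/-- `stillWaiting M n (h, e)`: the probability that a given `H` agent, in a market with `h` waiting
`H` agents (herself included, as the agent with index `0`) and `e` waiting `E` agents, has not been
matched by any of the next `n` arrivals. Each arrival is of type `T` with probability
`lam T / totalRate`. The state `h = 0` is not reached. -/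
def stillWaiting (M : Market) : ℕ → ℕ × ℕ → ℝ
  | 0, _ => 1
  | _ + 1, (0, _) => 0
  | n + 1, (h + 1, e) =>
    ∑ T ∈ ({AgentType.hard, AgentType.easy} : Finset AgentType),
      M.lam T / M.totalRate * ∑ o : Option (Agents (h + 1, e)),
        if o = some (Sum.inl (0 : Fin (h + 1))) then 0
        else matchProb M (h + 1, e) T o * stillWaiting M n (nextState (h + 1, e) T o)

/-- The probability that the waiting time (departure time minus arrival time) of an `H` agent who
arrives to the market in the steady state `π` exceeds `t`. Upon arrival she must find no match.
Afterwards, the number of arrivals during the next `t` time units is Poisson with mean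
`totalRate * t`, independently of the types and of the edges, and she must be matched by none
of these arrivals. -/
def waitTailH (M : Market) (π : ℕ × ℕ → ℝ) (t : ℝ) : ℝ :=
  ∑' s : ℕ × ℕ, π s * matchProb M s AgentType.hard none *
    ∑' n : ℕ, Real.exp (-(M.totalRate * t)) * (M.totalRate * t) ^ n / (n.factorial : ℝ) *
      stillWaiting M n (s.1 + 1, s.2)

/-- The average waiting time `w_H` of an `H` agent in steady state: the mean of the waiting time,
as the integral of its tail probabilities. -/
def avgWaitH (M : Market) (π : ℕ × ℕ → ℝ) : ENNReal :=
  ∫⁻ t in Set.Ioi (0 : ℝ), ENNReal.ofReal (waitTailH M π t)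

end

/-!
Write `λ` for the total arrival rate, `h` and `e` for the numbers of waiting `H` and `E` agents,
`N = h + e`, and `L` for the generator of the chain.

*Steady state.* Every two-cycle fails with probability at most some `r < 1`, so an arriving agent
joins with probability at most `r ^ N`, and `r⁻¹ ^ N` is a Lyapunov function of the embedded jump
chain (`jump_pow_lyapunov_le`). Cesàro averages of its laws are therefore tight, and any limit point
is a steady state with all moments of `N` finite (`exists_steadyState`). It is unique because the
total variation of the difference of two steady states is invariant again, and every invariant
measure charges the empty market (`IsSteadyState.unique`).

*Little's law.* Waiting `H` agents are exchangeable. Counting the `H` agents present after one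
arrival that stay for `n` more arrivals (`step_mul_stillWaiting`) and using invariance gives a
telescoping sum, whence `w_H = E[h] / λ_H` (`IsSteadyState.avgWaitH_eq`). It remains to find `E[h]`
asymptotically.

*Drift.* In steady state `E[L F] = 0` for `F` of at most quadratic growth. With `F = e ^ 2` this
bounds `E[e]` independently of `p_H` (`IsSteadyState.meanEasy_le`). The number `N` increases by one
if the arriving agent finds no partner and decreases by one otherwise, so the test function
`F = c / 2 * (N - x₀ / c) ^ 2` has a simple drift. Here `c` is such that
`x = c * h` makes a probability of no match exponential.

* If `λ_H > λ_E`, take `exp (-x) = (1 - p_H ^ 2) ^ h`. Up to errors of order `p_H`, the drift is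
  `-(x - x₀) * (λ_H * (1 - 2 * exp (-x)) + λ_E)`, which vanishes only at
  `x₀ = log (2 λ_H / (λ_H + λ_E))` (`deviation_hard_le`).
* If `λ_H < λ_E`, take `exp (-x) = (1 - p_H * p_E) ^ h =: z`. Now `Q = (1 - p_E ^ 2) ^ e`, the
  probability that an arriving `E` agent forms no cycle with an `E` agent, enters the drift. For
  frozen `h` the number `e` is a fast variable, whose balance equation `Q * z = 1 - Q` (on average)
  replaces `Q` by `1 / (1 + z)`. This averaging is done by subtracting a corrector `g(x) * e` from
  the test function. The drift becomes `-(x - x₀) * (λ_E * (1 - z) / (1 + z) - λ_H)`, which vanishes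
  only at `x₀ = log ((λ_E + λ_H) / (λ_E - λ_H))` (`deviation_easy_le`).

In both cases the mean of `|x - x₀|` tends to zero, so `c * E[h]` tends to `x₀`. In the second case
the limit of `p_H * w_H` is thus `log ((λ_E + λ_H) / (λ_E - λ_H)) / (p_E * λ_H)`, which lies between
the stated bounds.
-/

noncomputable section

/-! ### Matching probabilities -/

lemma sum_finset_prod_ite {α : Type*} [Fintype α] [DecidableEq α] (f g : α → ℝ) :
    ∑ t : Finset α, ∏ v, (if v ∈ t then f v else g v) = ∏ v, (f v + g v) := by
  rw [Fintype.prod_add]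
  refine Finset.sum_congr rfl fun t _ => ?_
  rw [Finset.prod_ite]
  congr 1
  · exact Finset.prod_congr (by ext; simp) fun _ _ => rfl
  · exact Finset.prod_congr (by ext; simp) fun _ _ => rfl

/-- The probability that no agent of `S` forms a two-cycle with the arriving agent: the cycles
with distinct agents are independent events. -/
lemma sum_edgeProb_disjoint (M : Market) (s : ℕ × ℕ) (T : AgentType) (S : Finset (Agents s)) :
    ∑ A : Finset (Agents s), ∑ B : Finset (Agents s),
      edgeProb M s T A B * (if Disjoint (A ∩ B) S then 1 else 0) =
    ∏ v : Agents s, if v ∈ S then 1 - M.p (agentType v) * M.p T else 1 := by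
  have hAB : ∀ A B : Finset (Agents s),
      edgeProb M s T A B * (if Disjoint (A ∩ B) S then 1 else 0) =
      ∏ v : Agents s, (if v ∈ B then
        (if v ∈ A then M.p (agentType v) else 1 - M.p (agentType v)) *
          (if v ∈ A ∧ v ∈ S then 0 else M.p T)
        else (if v ∈ A then M.p (agentType v) else 1 - M.p (agentType v)) * (1 - M.p T)) := by
    intro A B
    have hind : (if Disjoint (A ∩ B) S then (1 : ℝ) else 0) =
        ∏ v : Agents s, if v ∉ (A ∩ B) ∩ S then (1 : ℝ) else 0 := by
      rw [Finset.prod_ite_zero]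
      simp only [Finset.mem_univ, true_imp_iff, Finset.prod_const_one]
      refine if_congr ?_ rfl rfl
      rw [Finset.disjoint_iff_inter_eq_empty, Finset.eq_empty_iff_forall_notMem]
    rw [hind, edgeProb, ← Finset.prod_mul_distrib]
    refine Finset.prod_congr rfl fun v _ => ?_
    by_cases hA : v ∈ A <;> by_cases hB : v ∈ B <;> by_cases hS : v ∈ S <;> simp [hA, hB, hS]
  simp_rw [hAB, sum_finset_prod_ite]
  have hA : ∀ A : Finset (Agents s),
      ∏ v : Agents s, ((if v ∈ A then M.p (agentType v) else 1 - M.p (agentType v)) *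
          (if v ∈ A ∧ v ∈ S then 0 else M.p T) +
        (if v ∈ A then M.p (agentType v) else 1 - M.p (agentType v)) * (1 - M.p T)) =
      ∏ v : Agents s, (if v ∈ A then M.p (agentType v) * (if v ∈ S then 1 - M.p T else 1)
        else 1 - M.p (agentType v)) := by
    intro A
    refine Finset.prod_congr rfl fun v _ => ?_
    by_cases hA : v ∈ A <;> by_cases hS : v ∈ S <;> simp [hA, hS] <;> ring
  simp_rw [hA, sum_finset_prod_ite]
  refine Finset.prod_congr rfl fun v _ => ?_
  by_cases hS : v ∈ S
  · simp only [hS, if_true]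
    ring
  · simp [hS]

/-- The probability that an arriving agent of type `T` is not matched. -/
def noneProb (M : Market) (s : ℕ × ℕ) (T : AgentType) : ℝ :=
  (1 - M.pH * M.p T) ^ s.1 * (1 - M.pE * M.p T) ^ s.2

/-- The probability that an arriving agent of type `T` forms no two-cycle with an `E` agent. -/
def noEasyProb (M : Market) (s : ℕ × ℕ) (T : AgentType) : ℝ :=
  (1 - M.pE * M.p T) ^ s.2

/-- The set of the waiting `E` agents. -/
def easyAgents (s : ℕ × ℕ) : Finset (Agents s) :=
  Finset.univ.filter (fun v => agentType v = AgentType.easy)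

lemma inl_notMem_easyAgents {s : ℕ × ℕ} (i : Fin s.1) : Sum.inl i ∉ easyAgents s := by
  rw [easyAgents, Finset.mem_filter]
  exact fun h => AgentType.noConfusion h.2

lemma inr_mem_easyAgents {s : ℕ × ℕ} (j : Fin s.2) : Sum.inr j ∈ easyAgents s :=
  Finset.mem_filter.2 ⟨Finset.mem_univ _, rfl⟩

lemma filter_easy {s : ℕ × ℕ} (C : Finset (Agents s)) :
    C.filter (fun v => agentType v = AgentType.easy) = C ∩ easyAgents s := by
  rw [easyAgents, Finset.inter_filter, Finset.inter_univ]

lemma prod_cycle_easy (M : Market) (s : ℕ × ℕ) (T : AgentType) :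
    (∏ v : Agents s, if v ∈ easyAgents s then
      1 - M.p (agentType v) * M.p T else 1) = noEasyProb M s T := by
  rw [Fintype.prod_sum_type]
  simp [inl_notMem_easyAgents, inr_mem_easyAgents, agentType, noEasyProb, Market.p]

lemma matchProb_none (M : Market) (s : ℕ × ℕ) (T : AgentType) :
    matchProb M s T none = noneProb M s T := by
  have := sum_edgeProb_disjoint M s T Finset.univ
  rw [Fintype.prod_sum_type] at this
  simpa [matchProb, selectProb, noneProb, agentType, Market.p, Finset.disjoint_iff_inter_eq_empty]
    using this

lemma sum_selectProb_some {s : ℕ × ℕ} (C : Finset (Agents s)) :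
    ∑ v, selectProb C (some v) = 1 - selectProb C none := by
  have hne : C.Nonempty → (candidates C).Nonempty := by
    intro h
    unfold candidates
    split_ifs with h'
    exacts [h', h]
  simp only [selectProb]
  rcases C.eq_empty_or_nonempty with rfl | h
  · simp [candidates]
  · rw [if_neg h.ne_empty, Finset.sum_ite_mem, Finset.univ_inter, Finset.sum_const, nsmul_eq_mul,
      mul_one_div_cancel, sub_zero]
    exact_mod_cast (hne h).card_pos.ne'

lemma sum_selectProb_easy {s : ℕ × ℕ} (C : Finset (Agents s)) :
    ∑ j : Fin s.2, selectProb C (some (.inr j)) =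
      1 - if Disjoint C (easyAgents s) then 1 else 0 := by
  have hdis : Disjoint C (easyAgents s) ↔ ¬ (C ∩ easyAgents s).Nonempty := by
    rw [Finset.not_nonempty_iff_eq_empty, Finset.disjoint_iff_inter_eq_empty]
  by_cases h : (C ∩ easyAgents s).Nonempty
  · have hsum := sum_selectProb_some C
    have hl : ∀ i : Fin s.1, selectProb C (some (.inl i)) = 0 := fun i => by
      simp [selectProb, candidates, filter_easy, h, inl_notMem_easyAgents]
    have hC : C ≠ ∅ := by
      rintro rfl
      simp at h
    rw [Fintype.sum_sum_type] at hsum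
    simp only [hl, Finset.sum_const_zero, zero_add] at hsum
    rw [hsum, if_neg (not_not.2 h ∘ hdis.1)]
    simp [selectProb, hC]
  · rw [if_pos (hdis.2 h), sub_self]
    refine Finset.sum_eq_zero fun j _ => ?_
    have hj : Sum.inr j ∉ C := fun hj =>
      h ⟨_, Finset.mem_inter.2 ⟨hj, inr_mem_easyAgents j⟩⟩
    simp [selectProb, candidates, filter_easy, h, hj]

lemma sum_edgeProb (M : Market) (s : ℕ × ℕ) (T : AgentType) :
    ∑ A : Finset (Agents s), ∑ B : Finset (Agents s), edgeProb M s T A B = 1 := by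
  simpa using sum_edgeProb_disjoint M s T ∅

lemma sum_matchProb_easy (M : Market) (s : ℕ × ℕ) (T : AgentType) :
    ∑ j : Fin s.2, matchProb M s T (some (.inr j)) = 1 - noEasyProb M s T := by
  have h := sum_edgeProb_disjoint M s T (easyAgents s)
  have key : ∑ j : Fin s.2, matchProb M s T (some (.inr j)) =
      (∑ A : Finset (Agents s), ∑ B : Finset (Agents s), edgeProb M s T A B) -
      ∑ A : Finset (Agents s), ∑ B : Finset (Agents s),
        edgeProb M s T A B * (if Disjoint (A ∩ B) (easyAgents s) then 1 else 0) := by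
    simp only [matchProb]
    rw [Finset.sum_comm, ← Finset.sum_sub_distrib]
    refine Finset.sum_congr rfl fun A _ => ?_
    rw [Finset.sum_comm, ← Finset.sum_sub_distrib]
    refine Finset.sum_congr rfl fun B _ => ?_
    rw [← Finset.mul_sum, sum_selectProb_easy, mul_sub, mul_one]
  rw [key, h, prod_cycle_easy, sum_edgeProb]

lemma sum_matchProb (M : Market) (s : ℕ × ℕ) (T : AgentType) :
    ∑ o, matchProb M s T o = 1 := by
  rw [← sum_edgeProb M s T]
  simp only [matchProb]
  rw [Finset.sum_comm]
  refine Finset.sum_congr rfl fun A _ => ?_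
  rw [Finset.sum_comm]
  refine Finset.sum_congr rfl fun B _ => ?_
  rw [← Finset.mul_sum, Fintype.sum_option, sum_selectProb_some]
  ring

lemma sum_matchProb_hard (M : Market) (s : ℕ × ℕ) (T : AgentType) :
    ∑ i : Fin s.1, matchProb M s T (some (.inl i)) = noEasyProb M s T - noneProb M s T := by
  have h := sum_matchProb M s T
  rw [Fintype.sum_option, Fintype.sum_sum_type, matchProb_none, sum_matchProb_easy] at h
  linarith

/-- Waiting agents of the same type are equally likely to be selected. -/
lemma matchProb_perm (M : Market) (s : ℕ × ℕ) (T : AgentType) (σ : Equiv.Perm (Agents s))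
    (hσ : ∀ v, agentType (σ v) = agentType v) (v : Agents s) :
    matchProb M s T (some (σ v)) = matchProb M s T (some v) := by
  have hfilter : ∀ C : Finset (Agents s),
      (C.map σ.toEmbedding).filter (fun v => agentType v = AgentType.easy) =
        (C.filter (fun v => agentType v = AgentType.easy)).map σ.toEmbedding := by
    intro C
    rw [Finset.filter_map]
    congr 1
    exact Finset.filter_congr fun v _ => by simp [hσ]
  have hcand : ∀ C : Finset (Agents s),
      candidates (C.map σ.toEmbedding) = (candidates C).map σ.toEmbedding := by
    intro C
    simp only [candidates, hfilter, Finset.map_nonempty]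
    split_ifs <;> rfl
  simp only [matchProb]
  rw [← Equiv.sum_comp σ.finsetCongr]
  refine Finset.sum_congr rfl fun A _ => ?_
  rw [← Equiv.sum_comp σ.finsetCongr]
  refine Finset.sum_congr rfl fun B _ => ?_
  simp only [Equiv.finsetCongr_apply]
  congr 1
  · rw [edgeProb, ← Equiv.prod_comp σ]
    refine Finset.prod_congr rfl fun w _ => ?_
    simp [hσ]
  · rw [← Finset.map_inter]
    simp [selectProb, hcand]

lemma matchProb_hard (M : Market) (h e : ℕ) (T : AgentType) (i : Fin (h + 1)) :
    matchProb M (h + 1, e) T (some (.inl i)) =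
      (noEasyProb M (h + 1, e) T - noneProb M (h + 1, e) T) / (h + 1) := by
  have hi : ∀ j : Fin (h + 1), matchProb M (h + 1, e) T (some (.inl j)) =
      matchProb M (h + 1, e) T (some (.inl i)) := by
    intro j
    have := matchProb_perm M (h + 1, e) T
      (Equiv.sumCongr (Equiv.swap i j) (Equiv.refl (Fin e)))
      (by rintro (v | v) <;> rfl) (.inl i)
    simpa using this
  have hsum := sum_matchProb_hard M (h + 1, e) T
  simp only [hi, Finset.sum_const, Finset.card_univ, Fintype.card_fin, nsmul_eq_mul] at hsum
  rw [← hsum]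
  push_cast
  field_simp

lemma matchProb_nonneg (M : Market) (s : ℕ × ℕ) (T : AgentType) (o : Option (Agents s))
    (hM : ∀ T, 0 ≤ M.p T ∧ M.p T ≤ 1) : 0 ≤ matchProb M s T o := by
  refine Finset.sum_nonneg fun A _ => Finset.sum_nonneg fun B _ => mul_nonneg ?_ ?_
  · refine Finset.prod_nonneg fun v _ => mul_nonneg ?_ ?_
    · split_ifs
      exacts [(hM _).1, sub_nonneg.2 (hM _).2]
    · split_ifs
      exacts [(hM _).1, sub_nonneg.2 (hM _).2]
  · cases o <;> simp only [selectProb] <;> split_ifs <;> positivity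

/-! ### The generator of the chain -/

/-- The state after an agent of type `T` joins the waiting agents. -/
def joinState (s : ℕ × ℕ) : AgentType → ℕ × ℕ
  | .hard => (s.1 + 1, s.2)
  | .easy => (s.1, s.2 + 1)

/-- The mean of `g` after the arrival of an agent of type `T` to the market `s`. -/
def meanAfter (M : Market) (g : ℕ × ℕ → ℝ) (s : ℕ × ℕ) (T : AgentType) : ℝ :=
  noneProb M s T * g (joinState s T) + (1 - noEasyProb M s T) * g (s.1, s.2 - 1) +
    (noEasyProb M s T - noneProb M s T) * g (s.1 - 1, s.2)

/-- The transition operator of the chain, scaled by the total rate: the rate-weighted sum of `g`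
over the next states. -/
def step (M : Market) (g : ℕ × ℕ → ℝ) (s : ℕ × ℕ) : ℝ :=
  M.lamH * meanAfter M g s .hard + M.lamE * meanAfter M g s .easy

lemma sum_matchProb_mul (M : Market) (g : ℕ × ℕ → ℝ) (s : ℕ × ℕ) (T : AgentType) :
    ∑ o, matchProb M s T o * g (nextState s T o) = meanAfter M g s T := by
  rw [Fintype.sum_option, Fintype.sum_sum_type, meanAfter, matchProb_none]
  simp only [nextState, ← Finset.sum_mul, sum_matchProb_easy, sum_matchProb_hard]
  cases T <;> simp only [joinState] <;> ring

lemma hasSum_transRate_mul (M : Market) (g : ℕ × ℕ → ℝ) (s : ℕ × ℕ) :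
    HasSum (fun s' => transRate M s s' * g s') (step M g s) := by
  have h : ∀ T : AgentType, HasSum (fun s' => ∑ o : Option (Agents s),
      (if nextState s T o = s' then matchProb M s T o else 0) * g s') (meanAfter M g s T) := by
    intro T
    rw [← sum_matchProb_mul]
    refine hasSum_sum fun o _ => ?_
    have := hasSum_ite_eq (nextState s T o) (matchProb M s T o * g (nextState s T o))
    convert this using 1
    ext s'
    by_cases hs : s' = nextState s T o
    · simp [hs]
    · simp [hs, Ne.symm hs]
  have h2 := ((h .hard).mul_left M.lamH).add ((h .easy).mul_left M.lamE)
  have heq : (fun s' => transRate M s s' * g s') = fun s' =>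
      M.lamH * ∑ o : Option (Agents s),
        (if nextState s .hard o = s' then matchProb M s .hard o else 0) * g s' +
      M.lamE * ∑ o : Option (Agents s),
        (if nextState s .easy o = s' then matchProb M s .easy o else 0) * g s' := by
    funext s'
    rw [transRate, Finset.sum_pair (by decide), ← Finset.sum_mul, ← Finset.sum_mul]
    simp only [Market.lam]
    ring
  rw [heq]
  exact h2

lemma transRate_nonneg (M : Market) (s s' : ℕ × ℕ) (hM : ∀ T, 0 ≤ M.p T ∧ M.p T ≤ 1)
    (hl : ∀ T, 0 ≤ M.lam T) : 0 ≤ transRate M s s' := by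
  refine Finset.sum_nonneg fun T _ => mul_nonneg (hl T) (Finset.sum_nonneg fun o _ => ?_)
  split_ifs
  exacts [matchProb_nonneg M s T o hM, le_rfl]

/-! ### Admissible parameters and transition rates -/

/-- The range of the parameters: positive arrival rates, `pH` in `(0, 1)` and `pE` in `(0, 1]`. -/
structure Market.Admissible (M : Market) : Prop where
  lamH_pos : 0 < M.lamH
  lamE_pos : 0 < M.lamE
  pH_pos : 0 < M.pH
  pH_lt : M.pH < 1
  pE_pos : 0 < M.pE
  pE_le : M.pE ≤ 1

namespace Market.Admissible

variable {M : Market}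

lemma totalRate_pos (hM : M.Admissible) : 0 < M.totalRate := add_pos hM.lamH_pos hM.lamE_pos

lemma lam_nonneg (hM : M.Admissible) (T : AgentType) : 0 ≤ M.lam T := by
  cases T
  exacts [hM.lamH_pos.le, hM.lamE_pos.le]

lemma p_pos (hM : M.Admissible) (T : AgentType) : 0 < M.p T := by
  cases T
  exacts [hM.pH_pos, hM.pE_pos]

lemma p_le (hM : M.Admissible) (T : AgentType) : M.p T ≤ 1 := by
  cases T
  exacts [hM.pH_lt.le, hM.pE_le]

lemma p_mem (hM : M.Admissible) (T : AgentType) : 0 ≤ M.p T ∧ M.p T ≤ 1 :=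
  ⟨(hM.p_pos T).le, hM.p_le T⟩

lemma hard_mul_pos (hM : M.Admissible) (T : AgentType) : 0 < M.pH * M.p T :=
  mul_pos hM.pH_pos (hM.p_pos T)

lemma hard_mul_lt (hM : M.Admissible) (T : AgentType) : M.pH * M.p T < 1 :=
  mul_lt_one_of_nonneg_of_lt_one_left hM.pH_pos.le hM.pH_lt (hM.p_le T)

lemma easy_mul_pos (hM : M.Admissible) (T : AgentType) : 0 < M.pE * M.p T :=
  mul_pos hM.pE_pos (hM.p_pos T)

lemma easy_mul_le (hM : M.Admissible) (T : AgentType) : M.pE * M.p T ≤ 1 :=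
  mul_le_one₀ hM.pE_le (hM.p_pos T).le (hM.p_le T)

lemma noEasyProb_nonneg (hM : M.Admissible) (s : ℕ × ℕ) (T : AgentType) :
    0 ≤ noEasyProb M s T :=
  pow_nonneg (sub_nonneg.2 (hM.easy_mul_le T)) _

lemma noEasyProb_le (hM : M.Admissible) (s : ℕ × ℕ) (T : AgentType) : noEasyProb M s T ≤ 1 :=
  pow_le_one₀ (sub_nonneg.2 (hM.easy_mul_le T)) (by linarith [hM.easy_mul_pos T])

lemma noneProb_nonneg (hM : M.Admissible) (s : ℕ × ℕ) (T : AgentType) : 0 ≤ noneProb M s T :=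
  mul_nonneg (pow_nonneg (sub_nonneg.2 (hM.hard_mul_lt T).le) _) (hM.noEasyProb_nonneg s T)

lemma noneProb_le (hM : M.Admissible) (s : ℕ × ℕ) (T : AgentType) :
    noneProb M s T ≤ noEasyProb M s T :=
  mul_le_of_le_one_left (hM.noEasyProb_nonneg s T)
    (pow_le_one₀ (sub_nonneg.2 (hM.hard_mul_lt T).le) (by linarith [hM.hard_mul_pos T]))

lemma transRate_nonneg (hM : M.Admissible) (s s' : ℕ × ℕ) : 0 ≤ transRate M s s' :=
  _root_.transRate_nonneg M s s' hM.p_mem hM.lam_nonneg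

lemma meanAfter_mono (hM : M.Admissible) {f g : ℕ × ℕ → ℝ} (hfg : ∀ s, f s ≤ g s) (s : ℕ × ℕ)
    (T : AgentType) : meanAfter M f s T ≤ meanAfter M g s T := by
  have h1 := hM.noneProb_nonneg s T
  have h2 := sub_nonneg.2 (hM.noneProb_le s T)
  have h3 := sub_nonneg.2 (hM.noEasyProb_le s T)
  exact add_le_add (add_le_add (mul_le_mul_of_nonneg_left (hfg _) h1)
    (mul_le_mul_of_nonneg_left (hfg _) h3)) (mul_le_mul_of_nonneg_left (hfg _) h2)

lemma meanAfter_nonneg (hM : M.Admissible) {g : ℕ × ℕ → ℝ} (hg : ∀ s, 0 ≤ g s) (s : ℕ × ℕ)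
    (T : AgentType) : 0 ≤ meanAfter M g s T := by
  simpa [meanAfter] using hM.meanAfter_mono (f := fun _ => 0) hg s T

lemma step_mono (hM : M.Admissible) {f g : ℕ × ℕ → ℝ} (hfg : ∀ s, f s ≤ g s) (s : ℕ × ℕ) :
    step M f s ≤ step M g s :=
  add_le_add (mul_le_mul_of_nonneg_left (hM.meanAfter_mono hfg s _) hM.lamH_pos.le)
    (mul_le_mul_of_nonneg_left (hM.meanAfter_mono hfg s _) hM.lamE_pos.le)

end Market.Admissible

lemma step_const (M : Market) (c : ℝ) (s : ℕ × ℕ) : step M (fun _ => c) s = M.totalRate * c := by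
  simp only [step, meanAfter, Market.totalRate]
  ring

lemma hasSum_transRate (M : Market) (s : ℕ × ℕ) : HasSum (transRate M s) M.totalRate := by
  simpa [step_const] using hasSum_transRate_mul M (fun _ => 1) s

lemma transRate_eq_step (M : Market) (s s' : ℕ × ℕ) :
    transRate M s s' = step M (fun x => if x = s' then 1 else 0) s := by
  refine HasSum.unique ?_ (hasSum_transRate_mul M _ s)
  convert hasSum_ite_eq s' (transRate M s s') using 1
  funext x
  by_cases hx : x = s' <;> simp [hx]

lemma transRate_hard_pos {M : Market} (hM : M.Admissible) (h e : ℕ) :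
    0 < transRate M (h + 1, e) (h, e) := by
  rw [transRate_eq_step]
  have h0 : ∀ x : ℕ × ℕ, (0 : ℝ) ≤ (if x = (h, e) then 1 else 0) := fun x => by
    split_ifs <;> norm_num
  have hE := mul_nonneg hM.lamE_pos.le
    (hM.meanAfter_nonneg h0 (h + 1, e) .easy)
  refine add_pos_of_pos_of_nonneg (mul_pos hM.lamH_pos ?_) hE
  refine add_pos_of_nonneg_of_pos (add_nonneg (mul_nonneg (hM.noneProb_nonneg _ _) (h0 _))
    (mul_nonneg (sub_nonneg.2 (hM.noEasyProb_le _ _)) (h0 _))) ?_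
  have hlt : M.pE * M.pH < 1 := by
    have := hM.hard_mul_lt .easy
    rwa [mul_comm] at this
  have h1 : 0 < (1 - M.pE * M.p .hard) ^ e := pow_pos (sub_pos.2 hlt) _
  have h2 : (1 - M.pH * M.p .hard) ^ (h + 1) < 1 :=
    pow_lt_one₀ (sub_nonneg.2 (hM.hard_mul_lt _).le) (by linarith [hM.hard_mul_pos .hard])
      (Nat.succ_ne_zero h)
  simp only [noEasyProb, noneProb, add_tsub_cancel_right, if_true, mul_one]
  nlinarith

lemma transRate_easy_pos {M : Market} (hM : M.Admissible) (e : ℕ) :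
    0 < transRate M (0, e + 1) (0, e) := by
  rw [transRate_eq_step]
  have h0 : ∀ x : ℕ × ℕ, (0 : ℝ) ≤ (if x = (0, e) then 1 else 0) := fun x => by
    split_ifs <;> norm_num
  have hH := mul_nonneg hM.lamH_pos.le
    (hM.meanAfter_nonneg h0 (0, e + 1) .hard)
  refine add_pos_of_nonneg_of_pos hH (mul_pos hM.lamE_pos ?_)
  refine add_pos_of_pos_of_nonneg (add_pos_of_nonneg_of_pos
    (mul_nonneg (hM.noneProb_nonneg _ _) (h0 _)) ?_)
    (mul_nonneg (sub_nonneg.2 (hM.noneProb_le _ _)) (h0 _))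
  have h2 : (1 - M.pE * M.p .easy) ^ (e + 1) < 1 :=
    pow_lt_one₀ (sub_nonneg.2 (hM.easy_mul_le _)) (by linarith [hM.easy_mul_pos .easy])
      (Nat.succ_ne_zero e)
  simp only [noEasyProb, add_tsub_cancel_right, if_true, mul_one]
  linarith

/-! ### Invariant measures and uniqueness of the steady state -/

/-- The global balance equations of the chain. -/
def GlobalBalance (M : Market) (ν : ℕ × ℕ → ℝ) : Prop :=
  ∀ s', HasSum (fun s => ν s * transRate M s s') (M.totalRate * ν s')

lemma IsSteadyState.globalBalance {M : Market} {π : ℕ × ℕ → ℝ} (hπ : IsSteadyState M π) :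
    GlobalBalance M π := by
  intro s'
  have := hπ.balance s'
  rwa [(hasSum_transRate M s').tsum_eq, mul_comm] at this

/-- Invariance of the mean of a function of the state under one transition, by Fubini's theorem. -/
lemma GlobalBalance.hasSum_step {M : Market} (hM : M.Admissible) {ν : ℕ × ℕ → ℝ}
    (hν : GlobalBalance M ν) (h0 : ∀ s, 0 ≤ ν s) {g : ℕ × ℕ → ℝ}
    (hg : Summable fun s => ν s * |g s|) :
    HasSum (fun s => ν s * step M g s) (M.totalRate * ∑' s, ν s * g s) := by
  have hcol : ∀ (f : ℕ × ℕ → ℝ) (s' : ℕ × ℕ),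
      HasSum (fun s => ν s * transRate M s s' * f s') (M.totalRate * (ν s' * f s')) := by
    intro f s'
    have := (hν s').mul_right (f s')
    rwa [mul_assoc] at this
  have habs : Summable fun x : (ℕ × ℕ) × (ℕ × ℕ) => ν x.2 * transRate M x.2 x.1 * |g x.1| := by
    refine (summable_prod_of_nonneg fun x => ?_).2
      ⟨fun s' => (hcol (fun s => |g s|) s').summable, ?_⟩
    · exact mul_nonneg (mul_nonneg (h0 _) (hM.transRate_nonneg _ _)) (abs_nonneg _)
    · simp only [fun s' => (hcol (fun s => |g s|) s').tsum_eq]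
      exact hg.mul_left _
  have hF : Summable fun x : (ℕ × ℕ) × (ℕ × ℕ) => ν x.2 * transRate M x.2 x.1 * g x.1 := by
    refine Summable.of_abs (habs.congr fun x => ?_)
    rw [abs_mul, abs_of_nonneg (mul_nonneg (h0 _) (hM.transRate_nonneg _ _))]
  have h1 := hF.hasSum.prod_fiberwise (hcol g)
  have h2 := ((Equiv.prodComm (ℕ × ℕ) (ℕ × ℕ)).hasSum_iff.2 hF.hasSum).prod_fiberwise
    (g := fun s => ν s * step M g s) (fun s => by
      have := (hasSum_transRate_mul M g s).mul_left (ν s)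
      simpa [mul_assoc] using this)
  rwa [← h1.tsum_eq, tsum_mul_left] at h2

lemma GlobalBalance.eq_zero_of_transRate_pos {M : Market} (hM : M.Admissible) {ν : ℕ × ℕ → ℝ}
    (hν : GlobalBalance M ν) (h0 : ∀ s, 0 ≤ ν s) {s s' : ℕ × ℕ} (hs : 0 < transRate M s s')
    (hs' : ν s' = 0) : ν s = 0 := by
  have h := hν s'
  rw [hs', mul_zero, hasSum_zero_iff_of_nonneg
    (fun x => mul_nonneg (h0 x) (hM.transRate_nonneg _ _))] at h
  exact (mul_eq_zero.1 (congrFun h s)).resolve_right hs.ne'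

/-- The empty market is reachable from every state, so it is charged by every nonzero invariant
measure. -/
lemma GlobalBalance.eq_zero {M : Market} (hM : M.Admissible) {ν : ℕ × ℕ → ℝ}
    (hν : GlobalBalance M ν) (h0 : ∀ s, 0 ≤ ν s) (hz : ν (0, 0) = 0) : ∀ s, ν s = 0 := by
  have he : ∀ e, ν (0, e) = 0 := by
    intro e
    induction e with
    | zero => exact hz
    | succ e ih => exact hν.eq_zero_of_transRate_pos hM h0 (transRate_easy_pos hM e) ih
  rintro ⟨h, e⟩
  induction h with
  | zero => exact he e
  | succ h ih => exact hν.eq_zero_of_transRate_pos hM h0 (transRate_hard_pos hM h e) ih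

/-- The total variation of the difference of two invariant distributions is invariant, because
transitions do not increase it anywhere and preserve its total mass. -/
lemma GlobalBalance.abs {M : Market} (hM : M.Admissible) {d : ℕ × ℕ → ℝ}
    (hd : GlobalBalance M d) (hs : Summable fun s => |d s|) : GlobalBalance M fun s => |d s| := by
  have hR := hM.transRate_nonneg
  have hprod : Summable fun x : (ℕ × ℕ) × (ℕ × ℕ) => |d x.1| * transRate M x.1 x.2 := by
    have hrow : ∀ s, HasSum (fun s' => |d s| * transRate M s s') (|d s| * M.totalRate) :=
      fun s => (hasSum_transRate M s).mul_left |d s|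
    rw [summable_prod_of_nonneg fun x => mul_nonneg (abs_nonneg (d x.1)) (hR x.1 x.2)]
    refine ⟨fun s => (hrow s).summable, ?_⟩
    simp only [fun s => (hrow s).tsum_eq]
    exact hs.mul_right _
  have hcol : ∀ s', Summable fun s => |d s| * transRate M s s' := fun s' =>
    hprod.comp_injective (i := fun s => (s, s')) fun a b h => (Prod.ext_iff.1 h).1
  have h1 := hprod.hasSum.prod_fiberwise (fun s => (hasSum_transRate M s).mul_left |d s|)
  have h2 := ((Equiv.prodComm (ℕ × ℕ) (ℕ × ℕ)).hasSum_iff.2 hprod.hasSum).prod_fiberwise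
    (fun s' => (hcol s').hasSum)
  have hle : ∀ s', 0 ≤ ∑' s, |d s| * transRate M s s' - M.totalRate * |d s'| := by
    intro s'
    rw [sub_nonneg, ← abs_of_pos hM.totalRate_pos, ← abs_mul, ← (hd s').tsum_eq]
    have habs : (fun s => |d s| * transRate M s s') = fun s => |d s * transRate M s s'| := by
      funext s
      rw [abs_mul, abs_of_nonneg (hR _ _)]
    have hsn : Summable fun s => ‖d s * transRate M s s'‖ := by
      simpa only [habs, Real.norm_eq_abs] using hcol s'
    have := norm_tsum_le_tsum_norm hsn
    simpa only [habs, Real.norm_eq_abs] using this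
  have hzero := h2.sub (hs.hasSum.mul_left M.totalRate)
  rw [← h1.tsum_eq, tsum_mul_right, mul_comm, sub_self, hasSum_zero_iff_of_nonneg hle] at hzero
  intro s'
  have := congrFun hzero s'
  simp only [Pi.zero_apply, sub_eq_zero] at this
  rw [← this]
  exact (hcol s').hasSum

theorem IsSteadyState.unique {M : Market} (hM : M.Admissible) {π₁ π₂ : ℕ × ℕ → ℝ}
    (h₁ : IsSteadyState M π₁) (h₂ : IsSteadyState M π₂) : π₁ = π₂ := by
  set d : ℕ × ℕ → ℝ := fun s => π₁ s - π₂ s with hd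
  have hbal : GlobalBalance M d := fun s' => by
    simpa [hd, sub_mul, mul_sub] using (h₁.globalBalance s').sub (h₂.globalBalance s')
  have hsum : HasSum d 0 := by simpa using h₁.hasSum_one.sub h₂.hasSum_one
  have habs := hbal.abs hM hsum.summable.abs
  have hplus : GlobalBalance M fun s => |d s| + d s := fun s' => by
    simpa [add_mul, mul_add] using (habs s').add (hbal s')
  have hminus : GlobalBalance M fun s => |d s| - d s := fun s' => by
    simpa [sub_mul, mul_sub] using (habs s').sub (hbal s')
  -- The positive and negative parts of `d` cannot both charge the empty market.
  have hzero : ∀ s, d s = 0 := by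
    rcases le_total (d (0, 0)) 0 with h | h
    · have hz := hplus.eq_zero hM (fun s => by linarith [neg_abs_le (d s)])
        (by simp [abs_of_nonpos h])
      have hn : ∀ s, 0 ≤ -d s := fun s => by linarith [hz s, abs_nonneg (d s)]
      have := (hasSum_zero_iff_of_nonneg hn).1 (by simpa using hsum.neg)
      exact fun s => by simpa using congrFun this s
    · have hz := hminus.eq_zero hM (fun s => by linarith [le_abs_self (d s)])
        (by simp [abs_of_nonneg h])
      have hn : ∀ s, 0 ≤ d s := fun s => by linarith [hz s, abs_nonneg (d s)]
      have := (hasSum_zero_iff_of_nonneg hn).1 hsum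
      exact fun s => by simpa using congrFun this s
  funext s
  exact sub_eq_zero.1 (hzero s)

/-! ### Existence of the steady state -/

/-- The transition operator of the embedded jump chain. -/
def jump (M : Market) : Module.End ℝ (ℕ × ℕ → ℝ) where
  toFun g s := step M g s / M.totalRate
  map_add' f g := by
    funext s
    simp only [step, meanAfter, Pi.add_apply]
    ring
  map_smul' c g := by
    funext s
    simp only [step, meanAfter, Pi.smul_apply, smul_eq_mul, RingHom.id_apply]
    ring

lemma jump_apply (M : Market) (g : ℕ × ℕ → ℝ) (s : ℕ × ℕ) :
    jump M g s = step M g s / M.totalRate := rfl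

lemma jump_const {M : Market} (hM : M.Admissible) (c : ℝ) :
    jump M (fun _ => c) = fun _ => c := by
  funext s
  rw [jump_apply, step_const, mul_div_cancel_left₀ _ hM.totalRate_pos.ne']

lemma jump_pow_const {M : Market} (hM : M.Admissible) (c : ℝ) (n : ℕ) :
    (jump M ^ n) (fun _ => c) = fun _ => c := by
  induction n with
  | zero => rfl
  | succ n ih => rw [pow_succ, Module.End.mul_apply, jump_const hM, ih]

lemma jump_pow_mono {M : Market} (hM : M.Admissible) {f g : ℕ × ℕ → ℝ} (hfg : ∀ s, f s ≤ g s)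
    (n : ℕ) : ∀ s, (jump M ^ n) f s ≤ (jump M ^ n) g s := by
  induction n with
  | zero => exact hfg
  | succ n ih =>
    intro s
    rw [pow_succ', Module.End.mul_apply, Module.End.mul_apply, jump_apply, jump_apply]
    exact div_le_div_of_nonneg_right (hM.step_mono ih s) hM.totalRate_pos.le

/-- An upper bound, below one, on the probability that a given waiting agent does not form a
two-cycle with an arriving agent. -/
def missBound (M : Market) : ℝ := 1 - min M.pH M.pE ^ 2

lemma missBound_mem {M : Market} (hM : M.Admissible) : 0 < missBound M ∧ missBound M < 1 := by
  have h1 : 0 < min M.pH M.pE := lt_min hM.pH_pos hM.pE_pos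
  have h2 : min M.pH M.pE < 1 := (min_le_left _ _).trans_lt hM.pH_lt
  constructor <;> unfold missBound <;> nlinarith

lemma noneProb_le_missBound {M : Market} (hM : M.Admissible) (s : ℕ × ℕ) (T : AgentType) :
    noneProb M s T ≤ missBound M ^ (s.1 + s.2) := by
  have h1 : 0 < min M.pH M.pE := lt_min hM.pH_pos hM.pE_pos
  have hT : min M.pH M.pE ≤ M.p T := by
    cases T
    exacts [min_le_left _ _, min_le_right _ _]
  have hH : min M.pH M.pE ^ 2 ≤ M.pH * M.p T := by
    rw [sq]
    exact mul_le_mul (min_le_left _ _) hT h1.le hM.pH_pos.le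
  have hE : min M.pH M.pE ^ 2 ≤ M.pE * M.p T := by
    rw [sq]
    exact mul_le_mul (min_le_right _ _) hT h1.le hM.pE_pos.le
  rw [pow_add]
  refine mul_le_mul (pow_le_pow_left₀ (sub_nonneg.2 (hM.hard_mul_lt T).le) ?_ _)
    (pow_le_pow_left₀ (sub_nonneg.2 (hM.easy_mul_le T)) ?_ _)
    (hM.noEasyProb_nonneg s T) (pow_nonneg (missBound_mem hM).1.le _)
  · exact sub_le_sub_left hH 1
  · exact sub_le_sub_left hE 1

/-- A Lyapunov function: it decreases on average by a constant factor, up to a constant. -/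
def lyapunov (M : Market) (s : ℕ × ℕ) : ℝ := (missBound M)⁻¹ ^ (s.1 + s.2)

lemma meanAfter_lyapunov_le {M : Market} (hM : M.Admissible) (s : ℕ × ℕ) (T : AgentType) :
    meanAfter M (lyapunov M) s T ≤ missBound M * lyapunov M s + (missBound M)⁻¹ := by
  obtain ⟨hr0, hr1⟩ := missBound_mem hM
  set r := missBound M with hr
  have hup : lyapunov M (joinState s T) = r⁻¹ * lyapunov M s := by
    cases T <;> simp only [lyapunov, joinState, ← hr]
    · rw [show s.1 + 1 + s.2 = s.1 + s.2 + 1 by ring, pow_succ']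
    · rw [← add_assoc, pow_succ']
  have hV : 0 < lyapunov M s := pow_pos (inv_pos.2 hr0) _
  have h1 : noneProb M s T * lyapunov M (joinState s T) ≤ r⁻¹ := by
    rw [hup, mul_left_comm]
    refine mul_le_of_le_one_right (inv_pos.2 hr0).le ?_
    calc noneProb M s T * lyapunov M s ≤ r ^ (s.1 + s.2) * lyapunov M s :=
          mul_le_mul_of_nonneg_right (noneProb_le_missBound hM s T) hV.le
      _ = 1 := by
          rw [lyapunov, ← hr, ← mul_pow, mul_inv_cancel₀ hr0.ne', one_pow]
  have h2 : (1 - noEasyProb M s T) * lyapunov M (s.1, s.2 - 1) =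
      (1 - noEasyProb M s T) * (r * lyapunov M s) := by
    obtain ⟨h, e⟩ := s
    rcases e with _ | e
    · simp [noEasyProb]
    · congr 1
      simp only [lyapunov, ← hr, add_tsub_cancel_right]
      rw [← add_assoc, pow_succ', ← mul_assoc, mul_inv_cancel₀ hr0.ne', one_mul]
  have h3 : (noEasyProb M s T - noneProb M s T) * lyapunov M (s.1 - 1, s.2) =
      (noEasyProb M s T - noneProb M s T) * (r * lyapunov M s) := by
    obtain ⟨h, e⟩ := s
    rcases h with _ | h
    · simp [noEasyProb, noneProb]
    · congr 1
      simp only [lyapunov, ← hr, add_tsub_cancel_right]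
      rw [show h + 1 + e = h + e + 1 by ring, pow_succ', ← mul_assoc, mul_inv_cancel₀ hr0.ne',
        one_mul]
  have h4 := mul_nonneg (hM.noneProb_nonneg s T) (mul_pos hr0 hV).le
  rw [meanAfter, h2, h3]
  linarith

lemma jump_pow_lyapunov_le {M : Market} (hM : M.Admissible) (n : ℕ) (s : ℕ × ℕ) :
    (jump M ^ n) (lyapunov M) s ≤
      lyapunov M s + (missBound M)⁻¹ / (1 - missBound M) := by
  obtain ⟨hr0, hr1⟩ := missBound_mem hM
  have hV : 0 < lyapunov M s := pow_pos (inv_pos.2 hr0) _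
  have hdrift : ∀ s, jump M (lyapunov M) s ≤
      (missBound M • lyapunov M + (fun _ => (missBound M)⁻¹ : ℕ × ℕ → ℝ)) s := by
    intro s
    rw [jump_apply, div_le_iff₀ hM.totalRate_pos, step, Market.totalRate]
    have h1 := mul_le_mul_of_nonneg_left (meanAfter_lyapunov_le hM s .hard) hM.lamH_pos.le
    have h2 := mul_le_mul_of_nonneg_left (meanAfter_lyapunov_le hM s .easy) hM.lamE_pos.le
    simp only [Pi.add_apply, Pi.smul_apply, smul_eq_mul]
    linarith
  induction n with
  | zero =>
    have : 0 ≤ (missBound M)⁻¹ / (1 - missBound M) :=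
      div_nonneg (inv_pos.2 hr0).le (sub_pos.2 hr1).le
    simpa using this
  | succ n ih =>
    rw [pow_succ, Module.End.mul_apply]
    refine (jump_pow_mono hM hdrift n s).trans ?_
    rw [map_add, map_smul, jump_pow_const hM]
    simp only [Pi.add_apply, Pi.smul_apply, smul_eq_mul]
    have h1 := mul_le_mul_of_nonneg_left ih hr0.le
    have h2 : missBound M * ((missBound M)⁻¹ / (1 - missBound M)) + (missBound M)⁻¹ =
        (missBound M)⁻¹ / (1 - missBound M) := by
      have : 1 - missBound M ≠ 0 := (sub_pos.2 hr1).ne'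
      field_simp
      ring
    have h3 : missBound M * lyapunov M s ≤ lyapunov M s := mul_le_of_le_one_left hV.le hr1.le
    linarith

/-- The mean of a function of the state, averaged over the first `N + 1` transitions of the chain
started from the empty market. -/
def cesaro (M : Market) (N : ℕ) : (ℕ × ℕ → ℝ) →ₗ[ℝ] ℝ :=
  ((N : ℝ) + 1)⁻¹ • ∑ n ∈ Finset.range (N + 1), LinearMap.proj (0, 0) ∘ₗ (jump M ^ n)

lemma cesaro_apply (M : Market) (N : ℕ) (g : ℕ × ℕ → ℝ) :
    cesaro M N g = ((N : ℝ) + 1)⁻¹ * ∑ n ∈ Finset.range (N + 1), (jump M ^ n) g (0, 0) := by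
  simp [cesaro]

lemma cesaro_mono {M : Market} (hM : M.Admissible) (N : ℕ) {f g : ℕ × ℕ → ℝ}
    (hfg : ∀ s, f s ≤ g s) : cesaro M N f ≤ cesaro M N g := by
  rw [cesaro_apply, cesaro_apply]
  exact mul_le_mul_of_nonneg_left
    (Finset.sum_le_sum fun n _ => jump_pow_mono hM hfg n _) (by positivity)

lemma cesaro_const {M : Market} (hM : M.Admissible) (N : ℕ) (c : ℝ) :
    cesaro M N (fun _ => c) = c := by
  simp only [cesaro_apply, jump_pow_const hM, Finset.sum_const, Finset.card_range, nsmul_eq_mul]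
  push_cast
  field_simp

lemma cesaro_lyapunov_le {M : Market} (hM : M.Admissible) (N : ℕ) :
    cesaro M N (lyapunov M) ≤ lyapunov M (0, 0) + (missBound M)⁻¹ / (1 - missBound M) := by
  rw [cesaro_apply, inv_mul_le_iff₀ (by positivity)]
  refine (Finset.sum_le_card_nsmul _ _ _ fun n _ => jump_pow_lyapunov_le hM n (0, 0)).trans ?_
  rw [Finset.card_range, nsmul_eq_mul]
  push_cast
  exact le_rfl

lemma tendsto_cesaro_jump_sub {M : Market} (hM : M.Admissible) {g : ℕ × ℕ → ℝ}
    (h0 : ∀ s, 0 ≤ g s) (h1 : ∀ s, g s ≤ 1) :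
    Tendsto (fun N => cesaro M N (jump M g) - cesaro M N g) atTop (𝓝 0) := by
  have heq : ∀ N : ℕ, cesaro M N (jump M g) - cesaro M N g =
      ((N : ℝ) + 1)⁻¹ * ((jump M ^ (N + 1)) g (0, 0) - g (0, 0)) := by
    intro N
    rw [cesaro_apply, cesaro_apply, ← mul_sub, ← Finset.sum_sub_distrib]
    congr 1
    have := Finset.sum_range_sub (fun n => (jump M ^ n) g (0, 0)) (N + 1)
    simp only [pow_zero, Module.End.one_apply] at this
    rw [← this]
    refine Finset.sum_congr rfl fun n _ => ?_
    rw [pow_succ, Module.End.mul_apply]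
  have hb : ∀ N : ℕ, |cesaro M N (jump M g) - cesaro M N g| ≤ 1 / ((N : ℝ) + 1) := by
    intro N
    have h2 := jump_pow_mono hM (f := fun _ => 0) h0 (N + 1) (0, 0)
    have h3 := jump_pow_mono hM (g := fun _ => 1) h1 (N + 1) (0, 0)
    rw [jump_pow_const hM] at h2 h3
    rw [heq, abs_mul, abs_of_pos (by positivity), one_div]
    refine mul_le_of_le_one_right (by positivity) (abs_le.2 ⟨?_, ?_⟩) <;>
      linarith [h0 (0, 0), h1 (0, 0)]
  exact squeeze_zero_norm hb tendsto_one_div_add_atTop_nhds_zero_nat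

/-- The indicator function of a state. -/
def stateInd (s : ℕ × ℕ) : ℕ × ℕ → ℝ := fun x => if x = s then 1 else 0

lemma stateInd_nonneg (s x : ℕ × ℕ) : 0 ≤ stateInd s x := by
  unfold stateInd
  split_ifs <;> norm_num

lemma stateInd_le_one (s x : ℕ × ℕ) : stateInd s x ≤ 1 := by
  unfold stateInd
  split_ifs <;> norm_num

lemma sum_smul_stateInd (F : Finset (ℕ × ℕ)) (f : ℕ × ℕ → ℝ) (x : ℕ × ℕ) :
    (∑ s ∈ F, f s • stateInd s) x = if x ∈ F then f x else 0 := by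
  simp [Finset.sum_apply, stateInd]

lemma transRate_eq_zero (M : Market) {s s' : ℕ × ℕ}
    (h : s ∉ Finset.range (s'.1 + 2) ×ˢ Finset.range (s'.2 + 2)) : transRate M s s' = 0 := by
  obtain ⟨a, b⟩ := s
  obtain ⟨c, d⟩ := s'
  simp only [Finset.mem_product, Finset.mem_range] at h
  rw [transRate_eq_step]
  have h1 : ∀ T, joinState (a, b) T ≠ (c, d) := by
    intro T
    cases T <;> simp only [joinState, ne_eq, Prod.mk.injEq] <;> omega
  have h2 : (a, b - 1) ≠ (c, d) := by
    simp only [ne_eq, Prod.mk.injEq]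
    omega
  have h3 : (a - 1, b) ≠ (c, d) := by
    simp only [ne_eq, Prod.mk.injEq]
    omega
  simp [step, meanAfter, h1, h2, h3]

/-- The steady state is a limit of Cesàro averages of the laws of the jump chain, along an
ultrafilter. The Lyapunov function makes the averages tight, so that no mass is lost, and its mean
is finite in the limit. -/
theorem exists_steadyState {M : Market} (hM : M.Admissible) :
    ∃ π, IsSteadyState M π ∧ Summable fun s => π s * lyapunov M s := by
  obtain ⟨hr0, hr1⟩ := missBound_mem hM
  set C := lyapunov M (0, 0) + (missBound M)⁻¹ / (1 - missBound M) with hC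
  let U : Ultrafilter ℕ := hyperfilter ℕ
  have hU : (U : Filter ℕ) ≤ atTop := Nat.hyperfilter_le_atTop
  have hVpos : ∀ s, 0 < lyapunov M s := fun s => pow_pos (inv_pos.2 hr0) _
  have hind : ∀ (s : ℕ × ℕ) (N : ℕ), cesaro M N (stateInd s) ∈ Set.Icc (0 : ℝ) 1 := by
    intro s N
    constructor
    · simpa [cesaro_const hM] using cesaro_mono hM N (f := fun _ => 0) (stateInd_nonneg s)
    · simpa [cesaro_const hM] using cesaro_mono hM N (g := fun _ => 1) (stateInd_le_one s)
  have hlim : ∀ s, ∃ a, Tendsto (fun N => cesaro M N (stateInd s)) U (𝓝 a) := by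
    intro s
    obtain ⟨a, -, ha⟩ := isCompact_Icc.ultrafilter_le_nhds
      (U.map fun N => cesaro M N (stateInd s)) (by
        rw [Ultrafilter.coe_map, le_principal_iff, mem_map]
        exact Filter.univ_mem' (hind s))
    exact ⟨a, ha⟩
  choose π hπ using hlim
  have hfin : ∀ (F : Finset (ℕ × ℕ)) (f : ℕ × ℕ → ℝ),
      Tendsto (fun N => cesaro M N (∑ s ∈ F, f s • stateInd s)) U (𝓝 (∑ s ∈ F, π s * f s)) := by
    intro F f
    simp only [map_sum, map_smul, smul_eq_mul]
    refine tendsto_finsetSum _ fun s _ => ?_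
    rw [mul_comm]
    exact (hπ s).const_mul (f s)
  have hnonneg : ∀ s, 0 ≤ π s := fun s =>
    ge_of_tendsto (hπ s) (Eventually.of_forall fun N => (hind s N).1)
  have hle : ∀ F : Finset (ℕ × ℕ), ∑ s ∈ F, π s ≤ 1 := by
    intro F
    have h := hfin F fun _ => 1
    simp only [mul_one] at h
    refine le_of_tendsto h (Eventually.of_forall fun N => ?_)
    refine (cesaro_mono hM N (g := fun _ => 1) fun x => ?_).trans (cesaro_const hM N 1).le
    rw [sum_smul_stateInd F fun _ => 1]
    split_ifs <;> norm_num
  have hV : ∀ F : Finset (ℕ × ℕ), ∑ s ∈ F, π s * lyapunov M s ≤ C := by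
    intro F
    refine le_of_tendsto (hfin F (lyapunov M)) (Eventually.of_forall fun N => ?_)
    refine (cesaro_mono hM N fun x => ?_).trans (cesaro_lyapunov_le hM N)
    rw [sum_smul_stateInd]
    split_ifs
    exacts [le_rfl, (hVpos x).le]
  have htight : ∀ n : ℕ, 1 - C * missBound M ^ n ≤
      ∑ s ∈ Finset.range n ×ˢ Finset.range n, π s := by
    intro n
    have h := hfin (Finset.range n ×ˢ Finset.range n) fun _ => 1
    simp only [mul_one] at h
    refine ge_of_tendsto h (Eventually.of_forall fun N => ?_)
    have h1 : cesaro M N (fun _ => 1) ≤ cesaro M N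
        ((∑ s ∈ Finset.range n ×ˢ Finset.range n, (1 : ℝ) • stateInd s) +
          missBound M ^ n • lyapunov M) := by
      refine cesaro_mono hM N fun x => ?_
      rw [Pi.add_apply, sum_smul_stateInd _ fun _ => 1, Pi.smul_apply, smul_eq_mul]
      have hpos : 0 ≤ missBound M ^ n * lyapunov M x :=
        mul_nonneg (pow_nonneg hr0.le _) (hVpos x).le
      split_ifs with hx
      · linarith
      · have hn : n ≤ x.1 + x.2 := by
          simp only [Finset.mem_product, Finset.mem_range] at hx
          omega
        rw [zero_add, lyapunov, inv_pow, ← div_eq_mul_inv, one_le_div (pow_pos hr0 _)]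
        exact pow_le_pow_of_le_one hr0.le hr1.le hn
    rw [cesaro_const hM, map_add, map_smul, smul_eq_mul] at h1
    have h2 := mul_le_mul_of_nonneg_left (cesaro_lyapunov_le hM N) (pow_nonneg hr0.le n)
    linarith
  have hsum : Summable π := summable_of_sum_le hnonneg hle
  have hone : ∑' s, π s = 1 := by
    refine le_antisymm (hsum.tsum_le_of_sum_le hle) ?_
    have h : Tendsto (fun n : ℕ => 1 - C * missBound M ^ n) atTop (𝓝 (1 - C * 0)) :=
      ((tendsto_pow_atTop_nhds_zero_of_lt_one hr0.le hr1).const_mul C).const_sub 1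
    rw [mul_zero, sub_zero] at h
    exact le_of_tendsto' h fun n =>
      (htight n).trans (hsum.sum_le_tsum _ fun s _ => hnonneg s)
  refine ⟨π, ⟨hnonneg, hone ▸ hsum.hasSum, fun s' => ?_⟩,
    summable_of_sum_le (fun s => mul_nonneg (hnonneg s) (hVpos s).le) hV⟩
  rw [(hasSum_transRate M s').tsum_eq]
  set F := Finset.range (s'.1 + 2) ×ˢ Finset.range (s'.2 + 2) with hF
  have hfinite : HasSum (fun s => π s * transRate M s s') (∑ s ∈ F, π s * transRate M s s') :=
    hasSum_sum_of_ne_finset_zero fun s hs => by rw [transRate_eq_zero M hs, mul_zero]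
  have hjump : jump M (stateInd s') = M.totalRate⁻¹ • ∑ s ∈ F, transRate M s s' • stateInd s := by
    funext x
    rw [Pi.smul_apply, sum_smul_stateInd, jump_apply, div_eq_inv_mul, smul_eq_mul]
    congr 1
    rw [show step M (stateInd s') x = transRate M x s' from (transRate_eq_step M x s').symm]
    split_ifs with hx
    exacts [rfl, transRate_eq_zero M hx]
  have h1 := (hfin F fun s => transRate M s s').const_mul M.totalRate⁻¹
  have h2 := ((tendsto_cesaro_jump_sub hM (stateInd_nonneg s') (stateInd_le_one s')).mono_left
    hU).add (hπ s')
  have h3 : M.totalRate⁻¹ * ∑ s ∈ F, π s * transRate M s s' = 0 + π s' := by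
    refine tendsto_nhds_unique (h1.congr fun N => ?_) h2
    rw [hjump, map_smul, smul_eq_mul]
    ring
  rw [zero_add, inv_mul_eq_iff_eq_mul₀ hM.totalRate_pos.ne'] at h3
  rw [mul_comm, ← h3]
  exact hfinite

theorem existsUnique_steadyState {M : Market} (hM : M.Admissible) :
    ∃! π, IsSteadyState M π := by
  obtain ⟨π, hπ, -⟩ := exists_steadyState hM
  exact ⟨π, hπ, fun π' hπ' => hπ'.unique hM hπ⟩

/-- The number of waiting agents has a finite second moment in steady state. -/
lemma IsSteadyState.summable_sq {M : Market} (hM : M.Admissible) {π : ℕ × ℕ → ℝ}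
    (hπ : IsSteadyState M π) : Summable fun s => π s * ((s.1 : ℝ) + s.2 + 1) ^ 2 := by
  obtain ⟨π', hπ', hs⟩ := exists_steadyState hM
  obtain rfl := hπ.unique hM hπ'
  obtain ⟨hr0, hr1⟩ := missBound_mem hM
  have hθ : 1 < (missBound M)⁻¹ := (one_lt_inv₀ hr0).2 hr1
  obtain ⟨C, hC⟩ := (tendsto_pow_const_div_const_pow_of_one_lt 2 hθ).bddAbove_range
  refine Summable.of_nonneg_of_le (fun s => mul_nonneg (hπ.nonneg s) (sq_nonneg _)) (fun s => ?_)
    (hs.mul_left (C * (missBound M)⁻¹))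
  have h := hC ⟨s.1 + s.2 + 1, rfl⟩
  simp only [div_le_iff₀ (pow_pos (inv_pos.2 hr0) _)] at h
  push_cast at h
  have h2 := mul_le_mul_of_nonneg_left h (hπ.nonneg s)
  refine h2.trans (le_of_eq ?_)
  rw [lyapunov, pow_succ]
  ring

/-! ### Little's law -/

/-- The mean of `f` after the arrival of an agent of type `T` to the market `(h + 1, e)`, on the
event that a given one of the `h + 1` waiting `H` agents is not matched: an `H` agent that is
matched is another one with probability `h / (h + 1)`. -/
def taggedAfter (M : Market) (f : ℕ × ℕ → ℝ) (h e : ℕ) (T : AgentType) : ℝ :=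
  noneProb M (h + 1, e) T * f (joinState (h + 1, e) T) +
    (1 - noEasyProb M (h + 1, e) T) * f (h + 1, e - 1) +
    h / (h + 1) * (noEasyProb M (h + 1, e) T - noneProb M (h + 1, e) T) * f (h, e)

lemma taggedAfter_mono {M : Market} (hM : M.Admissible) {f g : ℕ × ℕ → ℝ}
    (hfg : ∀ s, f s ≤ g s) (h e : ℕ) (T : AgentType) :
    taggedAfter M f h e T ≤ taggedAfter M g h e T := by
  have h1 := hM.noneProb_nonneg (h + 1, e) T
  have h2 := sub_nonneg.2 (hM.noneProb_le (h + 1, e) T)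
  have h3 := sub_nonneg.2 (hM.noEasyProb_le (h + 1, e) T)
  exact add_le_add (add_le_add (mul_le_mul_of_nonneg_left (hfg _) h1)
    (mul_le_mul_of_nonneg_left (hfg _) h3))
    (mul_le_mul_of_nonneg_left (hfg _) (mul_nonneg (by positivity) h2))

lemma taggedAfter_one_le {M : Market} (hM : M.Admissible) (h e : ℕ) (T : AgentType) :
    taggedAfter M (fun _ => 1) h e T ≤ 1 := by
  have h2 := sub_nonneg.2 (hM.noneProb_le (h + 1, e) T)
  have h3 : (h : ℝ) / (h + 1) ≤ 1 := (div_le_one (by positivity)).2 (by linarith)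
  have h4 := mul_le_of_le_one_left h2 h3
  simp only [taggedAfter]
  linarith

lemma stillWaiting_succ (M : Market) (n h e : ℕ) :
    stillWaiting M (n + 1) (h + 1, e) =
      (M.lamH * taggedAfter M (stillWaiting M n) h e .hard +
        M.lamE * taggedAfter M (stillWaiting M n) h e .easy) / M.totalRate := by
  have hT : ∀ T : AgentType, (∑ o : Option (Agents (h + 1, e)),
      if o = some (Sum.inl (0 : Fin (h + 1))) then 0
        else matchProb M (h + 1, e) T o * stillWaiting M n (nextState (h + 1, e) T o)) =
      taggedAfter M (stillWaiting M n) h e T := by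
    intro T
    rw [Fintype.sum_option, Fintype.sum_sum_type]
    have hl : (∑ i : Fin (h + 1), if some (Sum.inl i : Agents (h + 1, e)) =
          some (Sum.inl (0 : Fin (h + 1))) then 0
        else matchProb M (h + 1, e) T (some (.inl i)) *
          stillWaiting M n (nextState (h + 1, e) T (some (.inl i)))) =
        h / (h + 1) * (noEasyProb M (h + 1, e) T - noneProb M (h + 1, e) T) *
          stillWaiting M n (h, e) := by
      rw [Fin.sum_univ_succ, if_pos rfl, zero_add]
      refine (Finset.sum_congr rfl fun i _ => (if_neg (by simp [Fin.succ_ne_zero])).trans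
        (congrArg (· * stillWaiting M n (h, e)) (matchProb_hard M h e T i.succ))).trans ?_
      rw [Finset.sum_const, Finset.card_univ, Fintype.card_fin, nsmul_eq_mul]
      ring
    have hr : (∑ j : Fin e, if some (Sum.inr j : Agents (h + 1, e)) =
          some (Sum.inl (0 : Fin (h + 1))) then 0
        else matchProb M (h + 1, e) T (some (.inr j)) *
          stillWaiting M n (nextState (h + 1, e) T (some (.inr j)))) =
        (1 - noEasyProb M (h + 1, e) T) * stillWaiting M n (h + 1, e - 1) := by
      rw [← sum_matchProb_easy, Finset.sum_mul]
      simp [nextState]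
    have hn : nextState (h + 1, e) T none = joinState (h + 1, e) T := by cases T <;> rfl
    refine (congrArg₂ (· + ·) (if_neg (by simp)) (congrArg₂ (· + ·) hl hr)).trans ?_
    rw [matchProb_none, hn, taggedAfter]
    ring
  rw [stillWaiting, Finset.sum_pair (by decide), hT, hT]
  simp only [Market.lam]
  ring

lemma stillWaiting_mem {M : Market} (hM : M.Admissible) (n : ℕ) :
    ∀ s, 0 ≤ stillWaiting M n s ∧ stillWaiting M n s ≤ 1 := by
  induction n with
  | zero => exact fun s => by simp [stillWaiting]
  | succ n ih =>
    rintro ⟨h, e⟩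
    rcases h with _ | h
    · simp [stillWaiting]
    have hlo : ∀ T, 0 ≤ taggedAfter M (stillWaiting M n) h e T := fun T => by
      simpa [taggedAfter] using
        taggedAfter_mono hM (f := fun _ => 0) (fun s => (ih s).1) h e T
    have hhi : ∀ T, taggedAfter M (stillWaiting M n) h e T ≤ 1 := fun T =>
      (taggedAfter_mono hM (g := fun _ => 1) (fun s => (ih s).2) h e T).trans
        (taggedAfter_one_le hM h e T)
    rw [stillWaiting_succ]
    refine ⟨div_nonneg (add_nonneg (mul_nonneg hM.lamH_pos.le (hlo _))
      (mul_nonneg hM.lamE_pos.le (hlo _))) hM.totalRate_pos.le,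
      (div_le_one hM.totalRate_pos).2 (add_le_add ?_ ?_)⟩
    · exact mul_le_of_le_one_right hM.lamH_pos.le (hhi _)
    · exact mul_le_of_le_one_right hM.lamE_pos.le (hhi _)

/-- The mean number of the `H` agents present after one arrival that stay for `n` more arrivals
counts those of the present agents that stay for `n + 1` arrivals, and the newcomer. -/
lemma step_mul_stillWaiting {M : Market} (hM : M.Admissible) (n : ℕ) (s : ℕ × ℕ) :
    step M (fun x => x.1 * stillWaiting M n x) s =
      M.totalRate * (s.1 * stillWaiting M (n + 1) s) +
        M.lamH * (noneProb M s .hard * stillWaiting M n (s.1 + 1, s.2)) := by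
  obtain ⟨h, e⟩ := s
  rcases h with _ | h
  · simp [step, meanAfter, joinState]
  · rw [stillWaiting_succ]
    have := hM.totalRate_pos.ne'
    simp only [step, meanAfter, taggedAfter, joinState, add_tsub_cancel_right]
    push_cast
    field_simp
    ring

/-- The mean number of waiting `H` agents. -/
def meanHard (π : ℕ × ℕ → ℝ) : ℝ := ∑' s, π s * (s.1 : ℝ)

lemma IsSteadyState.summable_of_le {M : Market} (hM : M.Admissible) {π : ℕ × ℕ → ℝ}
    (hπ : IsSteadyState M π) {f : ℕ × ℕ → ℝ} (C : ℝ)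
    (hf : ∀ s, |f s| ≤ C * ((s.1 : ℝ) + s.2 + 1) ^ 2) : Summable fun s => π s * f s := by
  refine Summable.of_norm_bounded ((hπ.summable_sq hM).mul_left C) fun s => ?_
  rw [Real.norm_eq_abs, abs_mul, abs_of_nonneg (hπ.nonneg s), mul_left_comm]
  exact mul_le_mul_of_nonneg_left (hf s) (hπ.nonneg s)

lemma IsSteadyState.summable_hard {M : Market} (hM : M.Admissible) {π : ℕ × ℕ → ℝ}
    (hπ : IsSteadyState M π) : Summable fun s => π s * (s.1 : ℝ) := by
  refine hπ.summable_of_le hM 1 fun s => ?_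
  have h1 : (0 : ℝ) ≤ s.1 := Nat.cast_nonneg _
  have h2 : (0 : ℝ) ≤ s.2 := Nat.cast_nonneg _
  rw [abs_of_nonneg h1]
  nlinarith

/-- The probability that an `H` agent arriving in steady state is not matched at once and still
waits after `n` more arrivals. -/
def waitAfter (M : Market) (π : ℕ × ℕ → ℝ) (n : ℕ) : ℝ :=
  ∑' s, π s * (noneProb M s .hard * stillWaiting M n (s.1 + 1, s.2))

lemma joinProb_mem {M : Market} (hM : M.Admissible) (n : ℕ) (s : ℕ × ℕ) :
    0 ≤ noneProb M s .hard * stillWaiting M n (s.1 + 1, s.2) ∧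
      noneProb M s .hard * stillWaiting M n (s.1 + 1, s.2) ≤ 1 := by
  have hu := stillWaiting_mem hM n (s.1 + 1, s.2)
  exact ⟨mul_nonneg (hM.noneProb_nonneg _ _) hu.1,
    mul_le_one₀ ((hM.noneProb_le _ _).trans (hM.noEasyProb_le _ _)) hu.1 hu.2⟩

lemma IsSteadyState.summable_waitAfter {M : Market} (hM : M.Admissible) {π : ℕ × ℕ → ℝ}
    (hπ : IsSteadyState M π) (n : ℕ) :
    Summable fun s => π s * (noneProb M s .hard * stillWaiting M n (s.1 + 1, s.2)) :=
  Summable.of_nonneg_of_le (fun s => mul_nonneg (hπ.nonneg s) (joinProb_mem hM n s).1)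
    (fun s => mul_le_of_le_one_right (hπ.nonneg s) (joinProb_mem hM n s).2)
    hπ.hasSum_one.summable

/-- Little's law, for the number of arrivals during the wait. -/
theorem IsSteadyState.hasSum_waitAfter {M : Market} (hM : M.Admissible) {π : ℕ × ℕ → ℝ}
    (hπ : IsSteadyState M π) :
    HasSum (waitAfter M π) (M.totalRate / M.lamH * meanHard π) := by
  have hlam := hM.lamH_pos
  have hrate := hM.totalRate_pos
  set G : ℕ → ℝ := fun n => ∑' s : ℕ × ℕ, π s * (s.1 * stillWaiting M n s) with hG
  have hle : ∀ n (s : ℕ × ℕ), π s * |s.1 * stillWaiting M n s| ≤ π s * (s.1 : ℝ) := by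
    intro n s
    have hu := stillWaiting_mem hM n s
    rw [abs_of_nonneg (mul_nonneg (Nat.cast_nonneg _) hu.1)]
    exact mul_le_mul_of_nonneg_left (mul_le_of_le_one_right (Nat.cast_nonneg _) hu.2)
      (hπ.nonneg s)
  have hsumabs : ∀ n, Summable fun s : ℕ × ℕ => π s * |s.1 * stillWaiting M n s| := fun n =>
    Summable.of_nonneg_of_le (fun s => mul_nonneg (hπ.nonneg s) (abs_nonneg _)) (hle n)
      (hπ.summable_hard hM)
  have hsum : ∀ n, Summable fun s : ℕ × ℕ => π s * (s.1 * stillWaiting M n s) := fun n =>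
    (hsumabs n).congr fun s => by
      rw [abs_of_nonneg (mul_nonneg (Nat.cast_nonneg _) (stillWaiting_mem hM n s).1)]
  have hrec : ∀ n, waitAfter M π n = M.totalRate / M.lamH * (G n - G (n + 1)) := by
    intro n
    have h1 := hπ.globalBalance.hasSum_step hM hπ.nonneg (hsumabs n)
    have h2 := ((hsum (n + 1)).hasSum.mul_left M.totalRate).add
      ((hπ.summable_waitAfter hM n).hasSum.mul_left M.lamH)
    have h3 : M.totalRate * G n = M.totalRate * G (n + 1) + M.lamH * waitAfter M π n := by
      have heq : (fun s : ℕ × ℕ => π s * step M (fun x => x.1 * stillWaiting M n x) s) =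
          fun s : ℕ × ℕ => M.totalRate * (π s * (s.1 * stillWaiting M (n + 1) s)) +
            M.lamH * (π s * (noneProb M s .hard * stillWaiting M n (s.1 + 1, s.2))) := by
        funext s
        rw [step_mul_stillWaiting hM]
        ring
      rw [heq] at h1
      exact h1.unique h2
    field_simp
    linarith
  have hpos : ∀ n, 0 ≤ waitAfter M π n := fun n =>
    tsum_nonneg fun s => mul_nonneg (hπ.nonneg s) (joinProb_mem hM n s).1
  have hpartial : ∀ N, ∑ n ∈ Finset.range N, waitAfter M π n =
      M.totalRate / M.lamH * (G 0 - G N) := by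
    intro N
    simp only [hrec]
    rw [← Finset.mul_sum, Finset.sum_range_sub']
  have hGnonneg : ∀ n, 0 ≤ G n := fun n => tsum_nonneg fun s =>
    mul_nonneg (hπ.nonneg s) (mul_nonneg (Nat.cast_nonneg _) (stillWaiting_mem hM n s).1)
  have hsummable : Summable (waitAfter M π) := by
    refine summable_of_sum_range_le (c := M.totalRate / M.lamH * G 0) hpos fun N => ?_
    rw [hpartial]
    exact mul_le_mul_of_nonneg_left (by linarith [hGnonneg N]) (by positivity)
  -- Summability forces an agent who joins in a state of positive mass to leave eventually, and
  -- `(h + 1, e)` has positive mass only if `(h, e)` has, since the former leads to the latter.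
  have hgone : ∀ s : ℕ × ℕ, Tendsto (fun n => π s * (s.1 * stillWaiting M n s)) atTop (𝓝 0) := by
    rintro ⟨h, e⟩
    rcases h with _ | h
    · simp
    rcases (hπ.nonneg (h, e)).eq_or_lt with hz | hp
    · rw [hπ.globalBalance.eq_zero_of_transRate_pos hM hπ.nonneg (transRate_hard_pos hM h e)
        hz.symm]
      simp
    · have hnone : 0 < noneProb M (h, e) .hard := by
        have hEH : M.pE * M.p .hard < 1 := by
          have := hM.hard_mul_lt .easy
          rwa [mul_comm] at this
        exact mul_pos (pow_pos (sub_pos.2 (hM.hard_mul_lt _)) _) (pow_pos (sub_pos.2 hEH) _)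
      have hu : Tendsto (fun n => stillWaiting M n (h + 1, e)) atTop (𝓝 0) := by
        have hc : 0 < π (h, e) * noneProb M (h, e) .hard := mul_pos hp hnone
        have hlim := hsummable.tendsto_atTop_zero.const_mul (π (h, e) * noneProb M (h, e) .hard)⁻¹
        rw [mul_zero] at hlim
        refine squeeze_zero (fun n => (stillWaiting_mem hM n _).1) (fun n => ?_) hlim
        rw [← div_eq_inv_mul, le_div_iff₀ hc]
        have := (hπ.summable_waitAfter hM n).le_tsum (h, e)
          fun s _ => mul_nonneg (hπ.nonneg s) (joinProb_mem hM n s).1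
        refine le_trans (le_of_eq ?_) this
        ring
      simpa using (hu.const_mul ((h + 1 : ℕ) : ℝ)).const_mul (π (h + 1, e))
  have hGlim : Tendsto G atTop (𝓝 0) := by
    have := tendsto_tsum_of_dominated_convergence (hπ.summable_hard hM) hgone
      (Eventually.of_forall fun n s => by
        have := hle n s
        rwa [Real.norm_eq_abs, abs_mul, abs_of_nonneg (hπ.nonneg s)])
    simpa using this
  rw [hasSum_iff_tendsto_nat_of_nonneg hpos]
  simp only [hpartial]
  have hG0 : G 0 = meanHard π := by simp [hG, meanHard, stillWaiting]
  simpa [hG0] using (hGlim.const_sub (G 0)).const_mul (M.totalRate / M.lamH)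

/-- The probability of `n` arrivals during a time `t`. -/
def poissonWeight (r : ℝ) (n : ℕ) (t : ℝ) : ℝ := Real.exp (-(r * t)) * (r * t) ^ n / n.factorial

lemma poissonWeight_nonneg {r t : ℝ} (hr : 0 < r) (ht : 0 < t) (n : ℕ) :
    0 ≤ poissonWeight r n t := by
  unfold poissonWeight
  positivity

lemma hasSum_poissonWeight (r t : ℝ) : HasSum (fun n => poissonWeight r n t) 1 := by
  have h := (NormedSpace.expSeries_div_hasSum_exp (r * t)).mul_left (Real.exp (-(r * t)))
  rw [← Real.exp_eq_exp_ℝ, ← Real.exp_add, neg_add_cancel, Real.exp_zero] at h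
  simpa only [poissonWeight, mul_div_assoc] using h

lemma lintegral_poissonWeight {r : ℝ} (hr : 0 < r) (n : ℕ) :
    ∫⁻ t in Set.Ioi (0 : ℝ), ENNReal.ofReal (poissonWeight r n t) = ENNReal.ofReal r⁻¹ := by
  have hint : ∫ t in Set.Ioi (0 : ℝ), poissonWeight r n t = r⁻¹ := by
    have h := Real.integral_rpow_mul_exp_neg_mul_Ioi (a := n + 1) (by positivity) hr
    rw [add_sub_cancel_right, Real.Gamma_nat_eq_factorial] at h
    have h2 : ∀ t : ℝ, poissonWeight r n t =
        r ^ n / n.factorial * (t ^ (n : ℝ) * Real.exp (-(r * t))) := by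
      intro t
      rw [poissonWeight, Real.rpow_natCast, mul_pow]
      ring
    simp only [h2]
    rw [MeasureTheory.integral_const_mul, h]
    have h3 : ((1 / r) ^ ((n : ℝ) + 1) : ℝ) = (1 / r) ^ (n + 1) := by
      exact_mod_cast Real.rpow_natCast (1 / r) (n + 1)
    rw [h3, one_div, inv_pow, pow_succ]
    have := (Nat.cast_pos (α := ℝ)).2 n.factorial_pos
    field_simp
  rw [← hint, MeasureTheory.ofReal_integral_eq_lintegral_ofReal]
  · exact not_imp_comm.1 MeasureTheory.integral_undef (by rw [hint]; positivity)
  · filter_upwards [MeasureTheory.ae_restrict_mem measurableSet_Ioi] with t ht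
    exact poissonWeight_nonneg hr ht n

/-- Little's law: the mean waiting time of the `H` agents is the mean number of waiting `H` agents
divided by their arrival rate. -/
theorem IsSteadyState.avgWaitH_eq {M : Market} (hM : M.Admissible) {π : ℕ × ℕ → ℝ}
    (hπ : IsSteadyState M π) : avgWaitH M π = ENNReal.ofReal (meanHard π / M.lamH) := by
  have hr := hM.totalRate_pos
  have htail : ∀ t ∈ Set.Ioi (0 : ℝ), ENNReal.ofReal (waitTailH M π t) =
      ∑' s : ℕ × ℕ, ∑' n : ℕ,
        ENNReal.ofReal (π s * (noneProb M s .hard * stillWaiting M n (s.1 + 1, s.2))) *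
          ENNReal.ofReal (poissonWeight M.totalRate n t) := by
    intro t ht
    have hw := fun n => poissonWeight_nonneg hr ht n
    have hsn : ∀ s : ℕ × ℕ, Summable fun n =>
        poissonWeight M.totalRate n t * stillWaiting M n (s.1 + 1, s.2) := fun s =>
      Summable.of_nonneg_of_le (fun n => mul_nonneg (hw n) (stillWaiting_mem hM n _).1)
        (fun n => mul_le_of_le_one_right (hw n) (stillWaiting_mem hM n _).2)
        (hasSum_poissonWeight _ t).summable
    have hI : ∀ s : ℕ × ℕ, 0 ≤ ∑' n, poissonWeight M.totalRate n t *
        stillWaiting M n (s.1 + 1, s.2) := fun s =>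
      tsum_nonneg fun n => mul_nonneg (hw n) (stillWaiting_mem hM n _).1
    have hI1 : ∀ s : ℕ × ℕ, ∑' n, poissonWeight M.totalRate n t *
        stillWaiting M n (s.1 + 1, s.2) ≤ 1 := fun s => by
      rw [← (hasSum_poissonWeight M.totalRate t).tsum_eq]
      exact (hsn s).tsum_le_tsum
        (fun n => mul_le_of_le_one_right (hw n) (stillWaiting_mem hM n _).2)
        (hasSum_poissonWeight _ t).summable
    have hjoin : ∀ s, 0 ≤ π s * noneProb M s .hard := fun s =>
      mul_nonneg (hπ.nonneg s) (hM.noneProb_nonneg _ _)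
    have hdef : waitTailH M π t = ∑' s : ℕ × ℕ, π s * noneProb M s .hard *
        ∑' n, poissonWeight M.totalRate n t * stillWaiting M n (s.1 + 1, s.2) := by
      simp only [waitTailH, matchProb_none, poissonWeight]
    rw [hdef, ENNReal.ofReal_tsum_of_nonneg]
    · refine tsum_congr fun s => ?_
      rw [← tsum_mul_left, ENNReal.ofReal_tsum_of_nonneg]
      · refine tsum_congr fun n => ?_
        rw [← ENNReal.ofReal_mul
          (mul_nonneg (hπ.nonneg s) (joinProb_mem hM n s).1)]
        congr 1
        ring
      · exact fun n => mul_nonneg (hjoin s) (mul_nonneg (hw n) (stillWaiting_mem hM n _).1)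
      · exact (hsn s).mul_left _
    · exact fun s => mul_nonneg (hjoin s) (hI s)
    · refine Summable.of_nonneg_of_le (fun s => mul_nonneg (hjoin s) (hI s)) (fun s => ?_)
        hπ.hasSum_one.summable
      rw [mul_assoc]
      exact mul_le_of_le_one_right (hπ.nonneg s) (mul_le_one₀
        ((hM.noneProb_le _ _).trans (hM.noEasyProb_le _ _)) (hI s) (hI1 s))
  have hmeas : ∀ n, Measurable fun t => ENNReal.ofReal (poissonWeight M.totalRate n t) := fun n =>
    ENNReal.measurable_ofReal.comp (by unfold poissonWeight; fun_prop)
  rw [avgWaitH, MeasureTheory.setLIntegral_congr_fun measurableSet_Ioi htail,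
    MeasureTheory.lintegral_tsum fun s => (Measurable.tsum fun n =>
      (hmeas n).const_mul _).aemeasurable]
  simp_rw [MeasureTheory.lintegral_tsum fun n => ((hmeas n).const_mul _).aemeasurable,
    MeasureTheory.lintegral_const_mul _ (hmeas _), lintegral_poissonWeight hr]
  rw [ENNReal.tsum_comm]
  simp_rw [ENNReal.tsum_mul_right]
  have hn : ∀ n, ∑' s : ℕ × ℕ, ENNReal.ofReal
      (π s * (noneProb M s .hard * stillWaiting M n (s.1 + 1, s.2))) =
      ENNReal.ofReal (waitAfter M π n) := fun n =>
    (ENNReal.ofReal_tsum_of_nonneg (fun s => mul_nonneg (hπ.nonneg s) (joinProb_mem hM n s).1)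
      (hπ.summable_waitAfter hM n)).symm
  have hpos : ∀ n, 0 ≤ waitAfter M π n := fun n =>
    tsum_nonneg fun s => mul_nonneg (hπ.nonneg s) (joinProb_mem hM n s).1
  have hsum := hπ.hasSum_waitAfter hM
  simp_rw [hn]
  rw [← ENNReal.ofReal_tsum_of_nonneg hpos hsum.summable, hsum.tsum_eq,
    ← ENNReal.ofReal_mul (hsum.nonneg hpos)]
  congr 1
  field_simp

/-! ### Drift inequalities in steady state -/

lemma meanAfter_cast_hard (M : Market) (f : ℝ → ℝ → ℝ) (s : ℕ × ℕ) :
    meanAfter M (fun x => f x.1 x.2) s .hard =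
      noneProb M s .hard * f (s.1 + 1) s.2 + (1 - noEasyProb M s .hard) * f s.1 (s.2 - 1) +
        (noEasyProb M s .hard - noneProb M s .hard) * f (s.1 - 1) s.2 := by
  obtain ⟨h, e⟩ := s
  rcases h with _ | h <;> rcases e with _ | e <;>
    simp [meanAfter, joinState, noneProb, noEasyProb]

lemma meanAfter_cast_easy (M : Market) (f : ℝ → ℝ → ℝ) (s : ℕ × ℕ) :
    meanAfter M (fun x => f x.1 x.2) s .easy =
      noneProb M s .easy * f s.1 (s.2 + 1) + (1 - noEasyProb M s .easy) * f s.1 (s.2 - 1) +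
        (noEasyProb M s .easy - noneProb M s .easy) * f (s.1 - 1) s.2 := by
  obtain ⟨h, e⟩ := s
  rcases h with _ | h <;> rcases e with _ | e <;>
    simp [meanAfter, joinState, noneProb, noEasyProb]

/-- In steady state the mean drift of a function of at most quadratic growth vanishes, so a lower
bound on the dissipation cannot have positive mean. -/
lemma IsSteadyState.tsum_dissipation_nonpos {M : Market} (hM : M.Admissible) {π : ℕ × ℕ → ℝ}
    (hπ : IsSteadyState M π) {F a : ℕ × ℕ → ℝ} {C : ℝ}
    (hF : ∀ s, |F s| ≤ C * ((s.1 : ℝ) + s.2 + 1) ^ 2) (ha : Summable fun s => π s * a s)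
    (h : ∀ s, step M F s - M.totalRate * F s ≤ -a s) : ∑' s, π s * a s ≤ 0 := by
  have hs := hπ.summable_of_le hM C hF
  have habs := hπ.summable_of_le hM (f := fun s => |F s|) C fun s => by rw [abs_abs]; exact hF s
  have h1 := (hπ.globalBalance.hasSum_step hM hπ.nonneg habs).sub
    (hs.hasSum.mul_left M.totalRate)
  rw [sub_self] at h1
  have h2 := hasSum_le (fun s => ?_) ha.hasSum h1.neg
  · simpa using h2
  · have := mul_le_mul_of_nonneg_left (h s) (hπ.nonneg s)
    linarith

lemma mul_one_sub_pow_le {t : ℝ} (ht : 0 < t) (ht1 : t ≤ 1) (n : ℕ) :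
    (n : ℝ) * (1 - t) ^ n ≤ 1 / t := by
  rw [le_div_iff₀ ht]
  have h1 : 1 + (n : ℝ) * t ≤ (1 + t) ^ n := one_add_mul_le_pow (by linarith) n
  have h2 : (1 - t) ^ n * (1 + t) ^ n ≤ 1 := by
    rw [← mul_pow]
    exact pow_le_one₀ (by nlinarith) (by nlinarith)
  have h3 : 0 ≤ (1 - t) ^ n := pow_nonneg (by linarith) n
  nlinarith [mul_le_mul_of_nonneg_left h1 h3]

lemma one_sub_pow_le_mul {t : ℝ} (ht1 : t ≤ 1) (n : ℕ) : 1 - (1 - t) ^ n ≤ t * n := by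
  have := one_add_mul_le_pow (a := -t) (by linarith) n
  rw [← sub_eq_add_neg] at this
  linarith

lemma IsSteadyState.summable_easy {M : Market} (hM : M.Admissible) {π : ℕ × ℕ → ℝ}
    (hπ : IsSteadyState M π) : Summable fun s => π s * (s.2 : ℝ) := by
  refine hπ.summable_of_le hM 1 fun s => ?_
  have h1 : (0 : ℝ) ≤ s.1 := Nat.cast_nonneg _
  have h2 : (0 : ℝ) ≤ s.2 := Nat.cast_nonneg _
  rw [abs_of_nonneg h2]
  nlinarith

/-- The mean number of waiting `E` agents is bounded independently of `pH`: among many waiting `E`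
agents, an arriving `E` agent finds a partner. -/
lemma IsSteadyState.meanEasy_le {M : Market} (hM : M.Admissible) {π : ℕ × ℕ → ℝ}
    (hπ : IsSteadyState M π) : ∑' s, π s * (s.2 : ℝ) ≤ 1 / 2 + 2 / (M.pE * M.pE) := by
  have hsum := hπ.summable_easy hM
  set B : ℝ := 1 / (M.pE * M.pE) with hB
  have ha : HasSum (fun s : ℕ × ℕ => π s * (M.lamE * (2 * s.2 - 1 - 4 * B)))
      (M.lamE * (2 * (∑' s, π s * (s.2 : ℝ)) - (1 + 4 * B))) := by
    have h := ((hsum.hasSum.mul_left 2).sub (hπ.hasSum_one.mul_right (1 + 4 * B))).mul_left M.lamE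
    rw [one_mul] at h
    refine h.congr_fun fun s => ?_
    ring
  have hle := hπ.tsum_dissipation_nonpos hM (F := fun s => (s.2 : ℝ) ^ 2) (C := 1)
    (fun s => by
      have h1 : (0 : ℝ) ≤ s.1 := Nat.cast_nonneg _
      have h2 : (0 : ℝ) ≤ s.2 := Nat.cast_nonneg _
      rw [abs_of_nonneg (sq_nonneg _)]
      nlinarith) ha.summable (fun s => by
      have hH := meanAfter_cast_hard M (fun _ y => y ^ 2) s
      have hE := meanAfter_cast_easy M (fun _ y => y ^ 2) s
      have h2 : (0 : ℝ) ≤ s.2 := Nat.cast_nonneg _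
      have hQ : (s.2 : ℝ) * noEasyProb M s .easy ≤ B :=
        mul_one_sub_pow_le (hM.easy_mul_pos .easy) (hM.easy_mul_le .easy) s.2
      have hn := hM.noneProb_le s .easy
      have hH0 : (1 - noEasyProb M s .hard) * (1 - 2 * (s.2 : ℝ)) ≤ 0 := by
        rcases Nat.eq_zero_or_pos s.2 with h0 | h0
        · simp [noEasyProb, h0]
        · have : (1 : ℝ) ≤ s.2 := by exact_mod_cast h0
          nlinarith [hM.noEasyProb_le s .hard]
      have hE0 : noneProb M s .easy * (2 * s.2 + 1) + (1 - noEasyProb M s .easy) * (1 - 2 * s.2) ≤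
          -(2 * s.2 - 1 - 4 * B) := by
        nlinarith
      have h3 := mul_le_mul_of_nonneg_left hH0 hM.lamH_pos.le
      have h4 := mul_le_mul_of_nonneg_left hE0 hM.lamE_pos.le
      rw [step, hH, hE, Market.totalRate]
      linarith)
  rw [ha.tsum_eq] at hle
  have h5 := nonpos_of_mul_nonpos_right hle hM.lamE_pos
  have h6 : 2 / (M.pE * M.pE) = 2 * B := by rw [hB]; ring
  rw [h6]
  linarith

/-- The mean distance of the scaled number `c * h` of waiting `H` agents from `x₀`. -/
def deviation (π : ℕ × ℕ → ℝ) (c x₀ : ℝ) : ℝ := ∑' s, π s * |c * (s.1 : ℝ) - x₀|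

lemma IsSteadyState.summable_deviation {M : Market} (hM : M.Admissible) {π : ℕ × ℕ → ℝ}
    (hπ : IsSteadyState M π) (c x₀ : ℝ) : Summable fun s => π s * |c * (s.1 : ℝ) - x₀| := by
  refine hπ.summable_of_le hM (|c| + |x₀|) fun s => ?_
  have h1 : (0 : ℝ) ≤ s.1 := Nat.cast_nonneg _
  have h2 : (0 : ℝ) ≤ s.2 := Nat.cast_nonneg _
  have h3 := abs_sub (c * (s.1 : ℝ)) x₀
  rw [abs_mul, abs_of_nonneg h1] at h3
  have h4 : (s.1 : ℝ) ≤ ((s.1 : ℝ) + s.2 + 1) ^ 2 := by nlinarith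
  have h5 : (1 : ℝ) ≤ ((s.1 : ℝ) + s.2 + 1) ^ 2 := by nlinarith
  rw [abs_abs, add_mul]
  exact h3.trans (add_le_add (mul_le_mul_of_nonneg_left h4 (abs_nonneg _))
    (le_mul_of_one_le_right (abs_nonneg _) h5))

lemma IsSteadyState.abs_meanHard_sub_le {M : Market} (hM : M.Admissible) {π : ℕ × ℕ → ℝ}
    (hπ : IsSteadyState M π) (c x₀ : ℝ) : |c * meanHard π - x₀| ≤ deviation π c x₀ := by
  have hs := ((hπ.summable_hard hM).hasSum.mul_left c).sub (hπ.hasSum_one.mul_right x₀)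
  rw [one_mul] at hs
  have hd := (hπ.summable_deviation hM c x₀).hasSum
  have h1 := hasSum_le (fun s => ?_) hs hd
  · have h2 := hasSum_le (fun s => ?_) hs.neg hd
    · exact abs_le.2 ⟨by simp only [meanHard, deviation] at *; linarith, h1⟩
    · have := mul_le_mul_of_nonneg_left (neg_le_abs (c * (s.1 : ℝ) - x₀)) (hπ.nonneg s)
      linarith
  · have := mul_le_mul_of_nonneg_left (le_abs_self (c * (s.1 : ℝ) - x₀)) (hπ.nonneg s)
    linarith

/-- A pointwise drift inequality that pulls `c * h` towards `x₀`, up to errors, bounds the mean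
deviation from `x₀`. -/
lemma IsSteadyState.deviation_le {M : Market} (hM : M.Admissible) {π : ℕ × ℕ → ℝ}
    (hπ : IsSteadyState M π) {F : ℕ × ℕ → ℝ} {c x₀ k δ A B D C : ℝ} (hB : 0 ≤ B) (hD : 0 ≤ D)
    (hF : ∀ s, |F s| ≤ C * ((s.1 : ℝ) + s.2 + 1) ^ 2)
    (h : ∀ s, step M F s - M.totalRate * F s ≤
      -(k * (|c * (s.1 : ℝ) - x₀| - δ)) + A + B * s.2 + D * (c * s.1)) :
    k * (deviation π c x₀ - δ) ≤
      A + B * (1 / 2 + 2 / (M.pE * M.pE)) + D * (x₀ + deviation π c x₀) := by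
  have hd := (hπ.summable_deviation hM c x₀).hasSum
  have hh := (hπ.summable_hard hM).hasSum
  have he := (hπ.summable_easy hM).hasSum
  have ha := (((hd.mul_left k).sub (hπ.hasSum_one.mul_right (k * δ + A))).sub
    (he.mul_left B)).sub (hh.mul_left (D * c))
  rw [one_mul] at ha
  have heq : (fun s : ℕ × ℕ => k * (π s * |c * (s.1 : ℝ) - x₀|) - π s * (k * δ + A) -
      B * (π s * (s.2 : ℝ)) - D * c * (π s * (s.1 : ℝ))) = fun s : ℕ × ℕ =>
      π s * (k * (|c * (s.1 : ℝ) - x₀| - δ) - A - B * s.2 - D * (c * s.1)) := by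
    funext s
    ring
  rw [heq] at ha
  have hle := hπ.tsum_dissipation_nonpos hM hF ha.summable fun s => (h s).trans (le_of_eq (by ring))
  rw [ha.tsum_eq] at hle
  have h1 := mul_le_mul_of_nonneg_left (hπ.meanEasy_le hM) hB
  have h2 := mul_le_mul_of_nonneg_left ((abs_le.1 (hπ.abs_meanHard_sub_le hM c x₀)).2) hD
  simp only [meanHard, deviation] at *
  linarith

lemma StrictMono.exists_coercive {S : ℝ → ℝ} (hS : StrictMono S) {x₀ : ℝ} (h0 : S x₀ = 0) {δ : ℝ}
    (hδ : 0 < δ) : ∃ k > 0, ∀ x, k * (|x - x₀| - δ) ≤ (x - x₀) * S x := by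
  have hr : 0 < S (x₀ + δ) := h0 ▸ hS (by linarith)
  have hl : S (x₀ - δ) < 0 := h0 ▸ hS (by linarith)
  refine ⟨min (S (x₀ + δ)) (-S (x₀ - δ)), lt_min hr (neg_pos.2 hl), fun x => ?_⟩
  set k := min (S (x₀ + δ)) (-S (x₀ - δ)) with hk
  have hk0 : 0 < k := lt_min hr (neg_pos.2 hl)
  have hk1 : k ≤ S (x₀ + δ) := min_le_left _ _
  have hk2 : k ≤ -S (x₀ - δ) := min_le_right _ _
  rcases le_total x₀ x with hx | hx
  · rw [abs_of_nonneg (sub_nonneg.2 hx)]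
    have hSx : 0 ≤ S x := h0 ▸ hS.monotone hx
    rcases le_total (x₀ + δ) x with hx2 | hx2
    · have : k ≤ S x := hk1.trans (hS.monotone hx2)
      nlinarith
    · nlinarith [mul_nonneg (sub_nonneg.2 hx) hSx]
  · rw [abs_of_nonpos (sub_nonpos.2 hx)]
    have hSx : S x ≤ 0 := h0 ▸ hS.monotone hx
    rcases le_total x (x₀ - δ) with hx2 | hx2
    · have : S x ≤ S (x₀ - δ) := hS.monotone hx2
      nlinarith
    · nlinarith [mul_nonneg_of_nonpos_of_nonpos (sub_nonpos.2 hx) hSx]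

lemma tendsto_zero_of_coercive {l : Filter ℝ} {d ε : ℝ → ℝ} (hd : ∀ᶠ p in l, 0 ≤ d p)
    (hε : Tendsto ε l (𝓝 0))
    (h : ∀ δ > 0, ∃ k > 0, ∀ᶠ p in l, k * (d p - δ) ≤ ε p * (1 + d p)) :
    Tendsto d l (𝓝 0) := by
  rw [Metric.tendsto_nhds]
  intro η hη
  obtain ⟨k, hk, hle⟩ := h (η / 8) (by positivity)
  have h1 : ∀ᶠ p in l, ε p < k / 2 := hε.eventually_lt_const (by positivity)
  have h2 : ∀ᶠ p in l, ε p < k * η / 8 := hε.eventually_lt_const (by positivity)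
  filter_upwards [hd, hle, h1, h2] with p hp0 hp hp1 hp2
  rw [Real.dist_eq, sub_zero, abs_of_nonneg hp0]
  have h3 : ε p * d p ≤ k / 2 * d p := mul_le_mul_of_nonneg_right hp1.le hp0
  have h4 : k * d p < k * η := by nlinarith [mul_pos hk hη]
  exact lt_of_mul_lt_mul_left h4 hk.le

lemma tendsto_neg_log_one_sub_div :
    Tendsto (fun t : ℝ => -Real.log (1 - t) / t) (𝓝[>] 0) (𝓝 1) := by
  have h : HasDerivAt (fun t : ℝ => -Real.log (1 - t)) 1 0 := by
    have := (((hasDerivAt_id (0 : ℝ)).const_sub 1).log (by simp)).neg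
    simp only [id, sub_zero, div_one, neg_neg] at this
    exact this
  have h2 := (hasDerivAt_iff_tendsto_slope_zero.1 h).mono_left
    (nhdsWithin_mono 0 fun t (ht : 0 < t) => ht.ne')
  refine h2.congr fun t => ?_
  simp [div_eq_inv_mul]

lemma exp_neg_log_mul {t : ℝ} (ht : t < 1) (n : ℕ) :
    Real.exp (-(-Real.log (1 - t) * n)) = (1 - t) ^ n := by
  rw [neg_mul, neg_neg, mul_comm, Real.exp_nat_mul, Real.exp_log (sub_pos.2 ht)]

lemma le_neg_log_one_sub {t : ℝ} (ht : t < 1) : t ≤ -Real.log (1 - t) := by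
  have := Real.log_le_sub_one_of_pos (sub_pos.2 ht)
  linarith

/-! ### More `H` arrivals than `E` arrivals -/

/-- The limiting restoring drift of the number of waiting `H` agents, when `x` is this number scaled
by `-log (1 - pH ^ 2)`: almost no `E` agents wait, and every `E` agent is matched with an `H` agent. -/
def restoringHard (lamH lamE x : ℝ) : ℝ := lamH * (1 - 2 * Real.exp (-x)) + lamE

lemma restoringHard_strictMono {lamH : ℝ} (lamE : ℝ) (hlamH : 0 < lamH) :
    StrictMono (restoringHard lamH lamE) := by
  intro x y hxy
  have := mul_lt_mul_of_pos_left (Real.exp_lt_exp.2 (neg_lt_neg hxy)) hlamH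
  simp only [restoringHard]
  linarith

lemma restoringHard_eq_zero {lamH lamE : ℝ} (hlamH : 0 < lamH) (hlamE : 0 < lamE) :
    restoringHard lamH lamE (Real.log (2 * lamH / (lamH + lamE))) = 0 := by
  rw [restoringHard, Real.exp_neg, Real.exp_log (by positivity)]
  field_simp
  ring

/-- The drift of the quadratic test function in a state with `x = c * h`. Here `w`, `u`, `z`, `Q` are
the probabilities of no two-cycle between an arriving `H` agent and the `H` agents, an arriving `H`
agent and the `E` agents, an arriving `E` agent and the `H` agents, and an arriving `E` agent and
the `E` agents. -/
lemma hard_drift_le {lamH lamE c k B x x₀ e w u z Q : ℝ} (hlamH : 0 < lamH) (hlamE : 0 < lamE)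
    (hc : 0 ≤ c) (hx : 0 ≤ x) (hx₀ : 0 ≤ x₀) (he : 0 ≤ e) (hw0 : 0 ≤ w) (hw1 : w ≤ 1)
    (hu1 : u ≤ 1) (hu : 1 - u ≤ k * e) (hz0 : 0 ≤ z) (hz1 : z ≤ 1) (hQ0 : 0 ≤ Q) (hQ1 : Q ≤ 1)
    (hxz : x * z ≤ B) :
    (x + c * e - x₀) * (2 * (lamH * (w * u) + lamE * (z * Q)) - (lamH + lamE)) ≤
      -((x - x₀) * (lamH * (1 - 2 * w) + lamE)) + 2 * lamE * B +
        (2 * lamH * x₀ * k + 2 * lamE * c + lamH * c) * e := by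
  have hce := mul_nonneg hc he
  have h1 : w * (1 - u) * (x₀ - (x + c * e)) ≤ x₀ * (k * e) := by
    have h0 : 0 ≤ w * (1 - u) := mul_nonneg hw0 (sub_nonneg.2 hu1)
    have h2 : w * (1 - u) ≤ k * e :=
      (mul_le_of_le_one_left (sub_nonneg.2 hu1) hw1).trans hu
    nlinarith [mul_nonneg h0 hx, mul_nonneg h0 hce, mul_le_mul_of_nonneg_left h2 hx₀]
  have h2 : z * Q * (x + c * e - x₀) ≤ B + c * e := by
    have h0 : 0 ≤ z * Q := mul_nonneg hz0 hQ0
    have h3 : z * Q * x ≤ B := by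
      have := mul_le_of_le_one_right (mul_nonneg hx hz0) hQ1
      linarith
    have h4 : z * Q * (c * e) ≤ c * e := mul_le_of_le_one_left hce (mul_le_one₀ hz1 hQ0 hQ1)
    nlinarith [mul_nonneg h0 hx₀]
  have h3 : c * e * (-(lamH * (1 - 2 * w) + lamE)) ≤ c * e * lamH := by
    refine mul_le_mul_of_nonneg_left ?_ hce
    nlinarith
  have h4 := mul_le_mul_of_nonneg_left h1 hlamH.le
  have h5 := mul_le_mul_of_nonneg_left h2 hlamE.le
  nlinarith

lemma noneProb_eq (M : Market) (s : ℕ × ℕ) (T : AgentType) :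
    noneProb M s T = (1 - M.pH * M.p T) ^ s.1 * noEasyProb M s T := rfl

lemma abs_sub_sq_le {a b n c : ℝ} (ha : 0 ≤ a) (hb : 0 ≤ b) (hc : 0 ≤ c) :
    |c / 2 * (a + b - n) ^ 2| ≤ c / 2 * (1 + |n|) ^ 2 * (a + b + 1) ^ 2 := by
  rw [abs_of_nonneg (by positivity), mul_assoc, ← mul_pow]
  refine mul_le_mul_of_nonneg_left ?_ (by positivity)
  refine sq_le_sq' ?_ ?_ <;>
    nlinarith [neg_abs_le n, le_abs_self n, abs_nonneg n, mul_nonneg (abs_nonneg n) ha,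
      mul_nonneg (abs_nonneg n) hb]

/-- The drift of the square of the distance of the number of waiting agents from `n`. -/
lemma step_sq_sub (M : Market) (c n : ℝ) (s : ℕ × ℕ) :
    step M (fun s => c / 2 * ((s.1 : ℝ) + s.2 - n) ^ 2) s -
        M.totalRate * (c / 2 * ((s.1 : ℝ) + s.2 - n) ^ 2) =
      c * ((s.1 : ℝ) + s.2 - n) * (2 * (M.lamH * noneProb M s .hard +
        M.lamE * noneProb M s .easy) - M.totalRate) + c / 2 * M.totalRate := by
  rw [step, meanAfter_cast_hard M (fun a b => c / 2 * (a + b - n) ^ 2),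
    meanAfter_cast_easy M (fun a b => c / 2 * (a + b - n) ^ 2), Market.totalRate]
  ring

lemma deviation_hard_le {M : Market} (hM : M.Admissible) {π : ℕ × ℕ → ℝ}
    (hπ : IsSteadyState M π) {c x₀ k δ : ℝ} (hc : c = -Real.log (1 - M.pH * M.pH))
    (hx₀ : 0 ≤ x₀)
    (hk : ∀ x, k * (|x - x₀| - δ) ≤ (x - x₀) * restoringHard M.lamH M.lamE x) :
    k * (deviation π c x₀ - δ) ≤
      (c / 2 * M.totalRate + 2 * M.lamE * (c / (M.pH * M.pE))) +
        (2 * M.lamH * x₀ * (M.pE * M.pH) + 2 * M.lamE * c + M.lamH * c) *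
          (1 / 2 + 2 / (M.pE * M.pE)) := by
  have hpp : M.pH * M.pH < 1 := hM.hard_mul_lt .hard
  have hc0 : 0 < c := hc ▸ (mul_pos hM.pH_pos hM.pH_pos).trans_le (le_neg_log_one_sub hpp)
  have hlamH := hM.lamH_pos
  have hlamE := hM.lamE_pos
  have hpH := hM.pH_pos
  have hpE := hM.pE_pos
  have h := hπ.deviation_le hM (F := fun s => c / 2 * ((s.1 : ℝ) + s.2 - x₀ / c) ^ 2)
    (c := c) (x₀ := x₀) (k := k) (δ := δ)
    (A := c / 2 * M.totalRate + 2 * M.lamE * (c / (M.pH * M.pE)))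
    (B := 2 * M.lamH * x₀ * (M.pE * M.pH) + 2 * M.lamE * c + M.lamH * c) (D := 0)
    (C := c / 2 * (1 + |x₀ / c|) ^ 2) (by positivity) le_rfl
    (fun s => abs_sub_sq_le (Nat.cast_nonneg _) (Nat.cast_nonneg _) hc0.le) (fun s => ?_)
  · linarith
  · have hw : Real.exp (-(c * s.1)) = (1 - M.pH * M.pH) ^ s.1 := by
      rw [hc]
      exact exp_neg_log_mul hpp s.1
    have hEH : M.pE * M.pH ≤ 1 := hM.easy_mul_le .hard
    have hHE : M.pH * M.pE < 1 := hM.hard_mul_lt .easy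
    have hxz : c * s.1 * (1 - M.pH * M.pE) ^ s.1 ≤ c / (M.pH * M.pE) := by
      have := mul_le_mul_of_nonneg_left
        (mul_one_sub_pow_le (hM.hard_mul_pos .easy) hHE.le s.1) hc0.le
      simp only [mul_one_div, Market.p] at this
      linarith [mul_assoc c (s.1 : ℝ) ((1 - M.pH * M.pE) ^ s.1)]
    have hd := hard_drift_le (x := c * s.1) (e := s.2) (w := (1 - M.pH * M.pH) ^ s.1)
      (u := noEasyProb M s .hard) (z := (1 - M.pH * M.pE) ^ s.1) (Q := noEasyProb M s .easy)
      (k := M.pE * M.pH) hlamH hlamE hc0.le (by positivity) hx₀ (Nat.cast_nonneg _)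
      (pow_nonneg (sub_nonneg.2 hpp.le) _) (pow_le_one₀ (sub_nonneg.2 hpp.le) (by nlinarith))
      (hM.noEasyProb_le _ _) (one_sub_pow_le_mul hEH s.2)
      (pow_nonneg (sub_nonneg.2 hHE.le) _) (pow_le_one₀ (sub_nonneg.2 hHE.le) (by nlinarith))
      (hM.noEasyProb_nonneg _ _) (hM.noEasyProb_le _ _) hxz
    have hks := hk (c * s.1)
    rw [restoringHard, hw] at hks
    have hn : c * ((s.1 : ℝ) + s.2 - x₀ / c) = c * s.1 + c * s.2 - x₀ := by
      field_simp
    rw [step_sq_sub, hn, noneProb_eq, noneProb_eq]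
    simp only [Market.p, Market.totalRate] at *
    linarith

/-! ### More `E` arrivals than `H` arrivals -/

/-- The correction to the quadratic test function. It replaces the fast variable, the number of
waiting `E` agents, by its mean when the number of `H` agents is frozen. -/
def corrector (x₀ x : ℝ) : ℝ := 2 * (x - x₀) / (1 + Real.exp x)

/-- The limiting restoring drift of the number of waiting `H` agents, when `x` is this number scaled
by `-log (1 - pH * pE)` and the number of waiting `E` agents is in equilibrium. -/
def restoringEasy (lamH lamE x : ℝ) : ℝ := lamE - lamH - lamE * (2 / (1 + Real.exp x))

lemma restoringEasy_strictMono (lamH : ℝ) {lamE : ℝ} (hlamE : 0 < lamE) :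
    StrictMono (restoringEasy lamH lamE) := by
  intro x y hxy
  have h1 : 2 / (1 + Real.exp y) < 2 / (1 + Real.exp x) :=
    div_lt_div_of_pos_left two_pos (by positivity) (by linarith [Real.exp_lt_exp.2 hxy])
  have := mul_lt_mul_of_pos_left h1 hlamE
  simp only [restoringEasy]
  linarith

lemma restoringEasy_eq_zero {lamH lamE : ℝ} (hlamH : 0 < lamH) (h : lamH < lamE) :
    restoringEasy lamH lamE (Real.log ((lamE + lamH) / (lamE - lamH))) = 0 := by
  have h1 : 0 < lamE - lamH := sub_pos.2 h
  have h2 : 0 < lamE := hlamH.trans h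
  have h3 : lamE - lamH + (lamE + lamH) ≠ 0 := by linarith
  rw [restoringEasy, Real.exp_log (by positivity)]
  field_simp
  ring

lemma abs_corrector_le {x₀ x : ℝ} (hx₀ : 0 ≤ x₀) (hx : 0 ≤ x) :
    |corrector x₀ x| ≤ 2 * (1 + x₀) := by
  have he := Real.add_one_le_exp x
  have hpos : 0 < 1 + Real.exp x := by positivity
  rw [corrector, abs_div, abs_of_pos hpos, div_le_iff₀ hpos, abs_le]
  constructor <;> nlinarith

lemma abs_corrector_sub_le {x₀ : ℝ} (hx₀ : 0 ≤ x₀) (x y : ℝ) :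
    |corrector x₀ y - corrector x₀ x| ≤ (4 + 2 * x₀) * |y - x| := by
  have hder : ∀ t : ℝ, HasDerivAt (corrector x₀)
      ((2 * (1 + Real.exp t) - 2 * (t - x₀) * Real.exp t) / (1 + Real.exp t) ^ 2) t := by
    intro t
    have h1 : HasDerivAt (fun t => 2 * (t - x₀)) 2 t := by
      simpa using ((hasDerivAt_id t).sub_const x₀).const_mul 2
    exact h1.div ((Real.hasDerivAt_exp t).const_add 1) (by positivity)
  refine Convex.norm_image_sub_le_of_norm_hasDerivWithin_le
    (fun t _ => (hder t).hasDerivWithinAt) (fun t _ => ?_) convex_univ (Set.mem_univ x)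
    (Set.mem_univ y)
  have hE : 0 < Real.exp t := Real.exp_pos t
  rw [Real.norm_eq_abs, abs_div, abs_of_pos (a := (1 + Real.exp t) ^ 2) (by positivity),
    div_le_iff₀ (by positivity), abs_le]
  -- The factor `t * exp t` is dominated by `exp t ^ 2` for positive and by `1` for negative `t`.
  have h1 : t * Real.exp t ≤ Real.exp t ^ 2 := by nlinarith [Real.add_one_le_exp t]
  have h2 : -(t * Real.exp t) ≤ 1 := by
    have h3 := mul_le_mul_of_nonneg_right (Real.add_one_le_exp (-t)) hE.le
    rw [← Real.exp_add, neg_add_cancel, Real.exp_zero] at h3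
    nlinarith
  constructor <;> nlinarith [mul_nonneg hx₀ hE.le, sq_nonneg (Real.exp t)]

/-- The drift of the corrected test function, with `w`, `u`, `z`, `Q` as in `hard_drift_le`, the value
`g` of the corrector and its increments `Δ₁`, `Δ₂` when an `H` agent joins or leaves. By the choice of
`g`, the terms with `Q` that are not small cancel. -/
lemma easy_drift_le {lamH lamE c k G L x x₀ e g w u z Q Δ₁ Δ₂ : ℝ} (hlamH : 0 < lamH)
    (h : lamH < lamE) (hc : 0 ≤ c) (hx : 0 ≤ x) (hx₀ : 0 ≤ x₀) (he : 0 ≤ e) (hw0 : 0 ≤ w)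
    (hw1 : w ≤ 1) (hu0 : 0 ≤ u) (hu1 : u ≤ 1) (hu : 1 - u ≤ k * e) (hz0 : 0 ≤ z) (hz1 : z ≤ 1)
    (hQ0 : 0 ≤ Q) (hQ1 : Q ≤ 1) (hg : g * (1 + z) = 2 * (x - x₀) * z) (hgG : |g| ≤ G)
    (hΔ₁ : |Δ₁| ≤ L * c) (hΔ₂ : |Δ₂| ≤ L * c) :
    (x + c * e - x₀) * (2 * (lamH * (w * u) + lamE * (z * Q)) - (lamH + lamE)) -
        (g * (lamE * (z * Q - (1 - Q)) - lamH * (1 - u)) +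
          e * (lamH * (w * u) * Δ₁ + (lamH * (u - w * u) + lamE * (Q - z * Q)) * Δ₂)) ≤
      -((x - x₀) * (lamE - lamH) - lamE * g) + 2 * lamH * x₀ * (1 - w) +
        (2 * lamH * x₀ * k + 2 * lamE * c + lamH * (G * k) + (lamH + lamE) * (L * c)) * e := by
  have hlamE : 0 < lamE := hlamH.trans h
  have hce := mul_nonneg hc he
  have hLc : 0 ≤ L * c := (abs_nonneg _).trans hΔ₁
  have hid : (x + c * e - x₀) * (2 * (lamH * (w * u) + lamE * (z * Q)) - (lamH + lamE)) -
      g * (lamE * (z * Q - (1 - Q)) - lamH * (1 - u)) =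
      -((x - x₀) * (lamE - lamH) - lamE * g) - c * e * (lamE - lamH) +
        2 * lamH * ((1 - w * u) * (x₀ - (x + c * e))) + 2 * lamE * (z * Q * (c * e)) +
          lamH * (g * (1 - u)) := by
    linear_combination (-lamE * Q) * hg
  have h1 : (1 - w * u) * (x₀ - (x + c * e)) ≤ x₀ * (1 - w) + x₀ * (k * e) := by
    have hwu : w * u ≤ 1 := mul_le_one₀ hw1 hu0 hu1
    have h2 : 1 - w * u ≤ (1 - w) + k * e := by
      nlinarith [mul_nonneg (sub_nonneg.2 hw1) (sub_nonneg.2 hu1)]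
    nlinarith [mul_le_mul_of_nonneg_left h2 hx₀, mul_nonneg (sub_nonneg.2 hwu) hx,
      mul_nonneg (sub_nonneg.2 hwu) hce]
  have h2 : z * Q * (c * e) ≤ c * e := mul_le_of_le_one_left hce (mul_le_one₀ hz1 hQ0 hQ1)
  have h3 : g * (1 - u) ≤ G * k * e := by
    have hu' := sub_nonneg.2 hu1
    calc g * (1 - u) ≤ G * (1 - u) :=
          mul_le_mul_of_nonneg_right ((le_abs_self g).trans hgG) hu'
      _ ≤ G * (k * e) := mul_le_mul_of_nonneg_left hu ((abs_nonneg g).trans hgG)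
      _ = G * k * e := by ring
  have h4 : -(lamH * (w * u) * Δ₁ + (lamH * (u - w * u) + lamE * (Q - z * Q)) * Δ₂) ≤
      (lamH + lamE) * (L * c) := by
    have ha : 0 ≤ lamH * (w * u) := by positivity
    have hb : 0 ≤ lamH * (u - w * u) + lamE * (Q - z * Q) := by
      have h5 : w * u ≤ u := mul_le_of_le_one_left hu0 hw1
      have h6 : z * Q ≤ Q := mul_le_of_le_one_left hQ0 hz1
      exact add_nonneg (mul_nonneg hlamH.le (sub_nonneg.2 h5))
        (mul_nonneg hlamE.le (sub_nonneg.2 h6))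
    have h5 := mul_le_mul_of_nonneg_left ((neg_le_abs Δ₁).trans hΔ₁) ha
    have h6 := mul_le_mul_of_nonneg_left ((neg_le_abs Δ₂).trans hΔ₂) hb
    have h7 : lamH * (w * u) + (lamH * (u - w * u) + lamE * (Q - z * Q)) ≤ lamH + lamE := by
      nlinarith [mul_nonneg hz0 hQ0, mul_nonneg hlamE.le (mul_nonneg hz0 hQ0)]
    have h8 := mul_le_mul_of_nonneg_right h7 hLc
    linarith
  have h5 := mul_le_mul_of_nonneg_left h1 hlamH.le
  have h6 := mul_le_mul_of_nonneg_left h2 hlamE.le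
  have h7 := mul_le_mul_of_nonneg_left h3 hlamH.le
  have h8 := mul_le_mul_of_nonneg_left h4 he
  have h9 := mul_nonneg hce (sub_pos.2 h).le
  linarith

lemma deviation_easy_le {M : Market} (hM : M.Admissible) (hlt : M.lamH < M.lamE)
    {π : ℕ × ℕ → ℝ} (hπ : IsSteadyState M π) {c x₀ k δ : ℝ}
    (hc : c = -Real.log (1 - M.pH * M.pE)) (hx₀ : 0 ≤ x₀)
    (hk : ∀ x, k * (|x - x₀| - δ) ≤ (x - x₀) * restoringEasy M.lamH M.lamE x) :
    k * (deviation π c x₀ - δ) ≤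
      c / 2 * M.totalRate +
        (2 * M.lamH * x₀ * (M.pE * M.pH) + 2 * M.lamE * c +
          M.lamH * (2 * (1 + x₀) * (M.pE * M.pH)) + M.totalRate * ((4 + 2 * x₀) * c)) *
            (1 / 2 + 2 / (M.pE * M.pE)) +
        2 * M.lamH * x₀ * (M.pH * M.pH / c) * (x₀ + deviation π c x₀) := by
  have hHE : M.pH * M.pE < 1 := hM.hard_mul_lt .easy
  have hpp : M.pH * M.pH < 1 := hM.hard_mul_lt .hard
  have hc0 : 0 < c := hc ▸ (mul_pos hM.pH_pos hM.pE_pos).trans_le (le_neg_log_one_sub hHE)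
  have hlamH := hM.lamH_pos
  have hlamE := hM.lamE_pos
  have hpH := hM.pH_pos
  have hpE := hM.pE_pos
  have hrate := hM.totalRate_pos
  refine hπ.deviation_le hM (F := fun s => c / 2 * ((s.1 : ℝ) + s.2 - x₀ / c) ^ 2 -
      corrector x₀ (c * s.1) * s.2)
    (C := c / 2 * (1 + |x₀ / c|) ^ 2 + 2 * (1 + x₀)) (by positivity) (by positivity)
    (fun s => ?_) (fun s => ?_)
  · have h1 : (0 : ℝ) ≤ s.1 := Nat.cast_nonneg _
    have h2 : (0 : ℝ) ≤ s.2 := Nat.cast_nonneg _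
    rw [add_mul]
    refine (abs_sub _ _).trans (add_le_add (abs_sub_sq_le h1 h2 hc0.le) ?_)
    rw [abs_mul, abs_of_nonneg h2]
    exact mul_le_mul (abs_corrector_le hx₀ (by positivity)) (by nlinarith) h2 (by positivity)
  · have hz : Real.exp (-(c * s.1)) = (1 - M.pH * M.pE) ^ s.1 := by
      rw [hc]
      exact exp_neg_log_mul hHE s.1
    have hEH : M.pE * M.pH ≤ 1 := hM.easy_mul_le .hard
    have hg : corrector x₀ (c * s.1) * (1 + (1 - M.pH * M.pE) ^ s.1) =
        2 * (c * s.1 - x₀) * (1 - M.pH * M.pE) ^ s.1 := by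
      rw [← hz, corrector, Real.exp_neg]
      have := Real.exp_pos (c * s.1)
      field_simp
      ring
    have hup := abs_corrector_sub_le hx₀ (c * s.1) (c * (s.1 + 1))
    have hdown := abs_corrector_sub_le hx₀ (c * s.1) (c * (s.1 - 1))
    rw [show c * ((s.1 : ℝ) + 1) - c * s.1 = c by ring, abs_of_pos hc0] at hup
    rw [show c * ((s.1 : ℝ) - 1) - c * s.1 = -c by ring, abs_neg, abs_of_pos hc0] at hdown
    have hd := easy_drift_le (x := c * s.1) (e := s.2) (w := (1 - M.pH * M.pH) ^ s.1)
      (u := noEasyProb M s .hard) (z := (1 - M.pH * M.pE) ^ s.1) (Q := noEasyProb M s .easy)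
      (k := M.pE * M.pH) hlamH hlt hc0.le (by positivity) hx₀ (Nat.cast_nonneg _)
      (pow_nonneg (sub_nonneg.2 hpp.le) _) (pow_le_one₀ (sub_nonneg.2 hpp.le) (by nlinarith))
      (hM.noEasyProb_nonneg _ _) (hM.noEasyProb_le _ _) (one_sub_pow_le_mul hEH s.2)
      (pow_nonneg (sub_nonneg.2 hHE.le) _) (pow_le_one₀ (sub_nonneg.2 hHE.le) (by nlinarith))
      (hM.noEasyProb_nonneg _ _) (hM.noEasyProb_le _ _) hg
      (abs_corrector_le hx₀ (by positivity)) hup hdown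
    have hks := hk (c * s.1)
    have hS : (c * s.1 - x₀) * restoringEasy M.lamH M.lamE (c * s.1) =
        (c * s.1 - x₀) * (M.lamE - M.lamH) - M.lamE * corrector x₀ (c * s.1) := by
      rw [restoringEasy, corrector]
      ring
    have hw : 2 * M.lamH * x₀ * (1 - (1 - M.pH * M.pH) ^ s.1) ≤
        2 * M.lamH * x₀ * (M.pH * M.pH / c) * (c * s.1) := by
      have h1 := mul_le_mul_of_nonneg_left (one_sub_pow_le_mul hpp.le s.1)
        (by positivity : 0 ≤ 2 * M.lamH * x₀)
      refine h1.trans (le_of_eq ?_)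
      field_simp
    have hn : c * ((s.1 : ℝ) + s.2 - x₀ / c) = c * s.1 + c * s.2 - x₀ := by
      field_simp
    have hsq := step_sq_sub M c (x₀ / c) s
    have hsub : step M (fun s => c / 2 * ((s.1 : ℝ) + s.2 - x₀ / c) ^ 2 -
        corrector x₀ (c * s.1) * s.2) s =
        step M (fun s => c / 2 * ((s.1 : ℝ) + s.2 - x₀ / c) ^ 2) s -
          step M (fun s => corrector x₀ (c * s.1) * s.2) s := by
      simp only [step, meanAfter]
      ring
    have hcor : step M (fun s => corrector x₀ (c * s.1) * s.2) s -
        M.totalRate * (corrector x₀ (c * s.1) * s.2) =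
        corrector x₀ (c * s.1) * (M.lamE * (noneProb M s .easy - (1 - noEasyProb M s .easy)) -
          M.lamH * (1 - noEasyProb M s .hard)) +
        s.2 * (M.lamH * noneProb M s .hard *
            (corrector x₀ (c * (s.1 + 1)) - corrector x₀ (c * s.1)) +
          (M.lamH * (noEasyProb M s .hard - noneProb M s .hard) +
            M.lamE * (noEasyProb M s .easy - noneProb M s .easy)) *
            (corrector x₀ (c * (s.1 - 1)) - corrector x₀ (c * s.1))) := by
      rw [step, meanAfter_cast_hard M (fun a b => corrector x₀ (c * a) * b),
        meanAfter_cast_easy M (fun a b => corrector x₀ (c * a) * b), Market.totalRate]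
      ring
    rw [hn] at hsq
    rw [hsub]
    simp only [noneProb_eq, Market.p, Market.totalRate] at *
    linarith

/-! ### The limits of the mean waiting times -/

section Limits

variable {lamH lamE pE : ℝ} {π : ℝ → ℕ × ℕ → ℝ}

lemma admissible_mk (hlamH : 0 < lamH) (hlamE : 0 < lamE) (hpE : 0 < pE) (hpE1 : pE ≤ 1) {pH : ℝ}
    (hpH : pH ∈ Set.Ioo (0 : ℝ) 1) : Market.Admissible ⟨lamH, lamE, pH, pE⟩ :=
  ⟨hlamH, hlamE, hpH.1, hpH.2, hpE, hpE1⟩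

lemma eventually_mem_Ioo : ∀ᶠ p : ℝ in 𝓝[>] 0, p ∈ Set.Ioo (0 : ℝ) 1 :=
  Ioo_mem_nhdsGT one_pos

lemma tendsto_id_nhdsGT : Tendsto (fun p : ℝ => p) (𝓝[>] 0) (𝓝 0) :=
  tendsto_id.mono_left nhdsWithin_le_nhds

lemma tendsto_nhdsGT_of_pos {f : ℝ → ℝ} (hf : Tendsto f (𝓝[>] 0) (𝓝 0)) (hpos : ∀ p > 0, 0 < f p) :
    Tendsto f (𝓝[>] 0) (𝓝[>] 0) :=
  tendsto_nhdsWithin_iff.2 ⟨hf, by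
    filter_upwards [self_mem_nhdsWithin] with p hp using hpos p hp⟩

lemma deviation_nonneg {M : Market} {ν : ℕ × ℕ → ℝ} (hν : IsSteadyState M ν) (c x₀ : ℝ) :
    0 ≤ deviation ν c x₀ :=
  tsum_nonneg fun s => mul_nonneg (hν.nonneg s) (abs_nonneg _)

/-- With more `H` than `E` arrivals, the number of waiting `H` agents concentrates at the scale
`pH⁻²`. -/
theorem tendsto_meanHard_of_gt (hlamE : 0 < lamE) (hpE : 0 < pE) (hpE1 : pE ≤ 1)
    (hlt : lamE < lamH)
    (hπ : ∀ pH ∈ Set.Ioo (0 : ℝ) 1, IsSteadyState ⟨lamH, lamE, pH, pE⟩ (π pH)) :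
    Tendsto (fun pH : ℝ => pH ^ 2 * meanHard (π pH)) (𝓝[>] 0)
      (𝓝 (Real.log (2 * lamH / (lamH + lamE)))) := by
  have hlamH : 0 < lamH := hlamE.trans hlt
  set x₀ := Real.log (2 * lamH / (lamH + lamE)) with hx₀
  have hx₀0 : 0 ≤ x₀ := Real.log_nonneg ((one_le_div (by positivity)).2 (by linarith))
  set c : ℝ → ℝ := fun p => -Real.log (1 - p * p) with hc
  have hp := tendsto_id_nhdsGT
  have hpp : Tendsto (fun p : ℝ => p * p) (𝓝[>] 0) (𝓝 0) := by simpa using hp.mul hp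
  have hratio : Tendsto (fun p => c p / (p * p)) (𝓝[>] 0) (𝓝 1) :=
    tendsto_neg_log_one_sub_div.comp (tendsto_nhdsGT_of_pos hpp fun p hp => mul_pos hp hp)
  have hcp : Tendsto (fun p => c p / (p * pE)) (𝓝[>] 0) (𝓝 0) := by
    have h := (hratio.mul hp).div_const pE
    rw [mul_zero, zero_div] at h
    refine h.congr' ?_
    filter_upwards [eventually_mem_Ioo] with p hp0
    have := hp0.1.ne'
    field_simp
  have hc0 : Tendsto c (𝓝[>] 0) (𝓝 0) := by
    have h := hratio.mul hpp
    rw [mul_zero] at h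
    refine h.congr' ?_
    filter_upwards [eventually_mem_Ioo] with p hp0
    have := hp0.1.ne'
    field_simp
  have hdev : Tendsto (fun p => deviation (π p) (c p) x₀) (𝓝[>] 0) (𝓝 0) := by
    refine tendsto_zero_of_coercive (ε := fun p =>
      (c p / 2 * (lamH + lamE) + 2 * lamE * (c p / (p * pE))) +
        (2 * lamH * x₀ * (pE * p) + 2 * lamE * c p + lamH * c p) *
          (1 / 2 + 2 / (pE * pE))) ?_ ?_ fun δ hδ => ?_
    · filter_upwards [eventually_mem_Ioo] with p hp0 using deviation_nonneg (hπ p hp0) _ _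
    · have h := (((hc0.div_const 2).mul_const (lamH + lamE)).add (hcp.const_mul (2 * lamE))).add
        (((((hp.const_mul pE).const_mul (2 * lamH * x₀)).add (hc0.const_mul (2 * lamE))).add
          (hc0.const_mul lamH)).mul_const (1 / 2 + 2 / (pE * pE)))
      simpa using h
    · obtain ⟨k, hk, hcoer⟩ := (restoringHard_strictMono lamE hlamH).exists_coercive
        (restoringHard_eq_zero hlamH hlamE) hδ
      refine ⟨k, hk, ?_⟩
      filter_upwards [eventually_mem_Ioo] with p hp0
      have hM := admissible_mk hlamH hlamE hpE hpE1 hp0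
      have h := deviation_hard_le hM (hπ p hp0) (c := c p) rfl hx₀0 hcoer
      have hcpos : 0 < c p := (mul_pos hp0.1 hp0.1).trans_le
        (le_neg_log_one_sub (hM.hard_mul_lt .hard))
      have hppos := hp0.1
      refine h.trans (le_mul_of_one_le_right ?_ ?_)
      · simp only [Market.totalRate]
        positivity
      · linarith [deviation_nonneg (hπ p hp0) (c p) x₀]
  have hmean : Tendsto (fun p => c p * meanHard (π p)) (𝓝[>] 0) (𝓝 x₀) := by
    rw [tendsto_iff_norm_sub_tendsto_zero]
    refine squeeze_zero' (Eventually.of_forall fun p => norm_nonneg _) ?_ hdev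
    filter_upwards [eventually_mem_Ioo] with p hp0
    exact (hπ p hp0).abs_meanHard_sub_le (admissible_mk hlamH hlamE hpE hpE1 hp0) _ _
  have h := hmean.div hratio one_ne_zero
  rw [div_one] at h
  refine h.congr' ?_
  filter_upwards [eventually_mem_Ioo] with p hp0
  have hcpos : 0 < c p := (mul_pos hp0.1 hp0.1).trans_le
    (le_neg_log_one_sub ((admissible_mk hlamH hlamE hpE hpE1 hp0).hard_mul_lt .hard))
  have := hp0.1.ne'
  simp only [Pi.div_apply]
  field_simp

/-- With more `E` than `H` arrivals, the number of waiting `H` agents concentrates at the scale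
`pH⁻¹`. -/
theorem tendsto_meanHard_of_lt (hlamH : 0 < lamH) (hpE : 0 < pE) (hpE1 : pE ≤ 1)
    (hlt : lamH < lamE)
    (hπ : ∀ pH ∈ Set.Ioo (0 : ℝ) 1, IsSteadyState ⟨lamH, lamE, pH, pE⟩ (π pH)) :
    Tendsto (fun pH : ℝ => pH * meanHard (π pH)) (𝓝[>] 0)
      (𝓝 (Real.log ((lamE + lamH) / (lamE - lamH)) / pE)) := by
  have hlamE : 0 < lamE := hlamH.trans hlt
  set x₀ := Real.log ((lamE + lamH) / (lamE - lamH)) with hx₀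
  have hx₀0 : 0 ≤ x₀ := Real.log_nonneg ((one_le_div (sub_pos.2 hlt)).2 (by linarith))
  set c : ℝ → ℝ := fun p => -Real.log (1 - p * pE) with hc
  have hp := tendsto_id_nhdsGT
  have hpq : Tendsto (fun p : ℝ => p * pE) (𝓝[>] 0) (𝓝 0) := by simpa using hp.mul_const pE
  have hratio : Tendsto (fun p => c p / (p * pE)) (𝓝[>] 0) (𝓝 1) :=
    tendsto_neg_log_one_sub_div.comp (tendsto_nhdsGT_of_pos hpq fun p hp => mul_pos hp hpE)
  have hcpos : ∀ p ∈ Set.Ioo (0 : ℝ) 1, 0 < c p := fun p hp0 => (mul_pos hp0.1 hpE).trans_le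
    (le_neg_log_one_sub ((admissible_mk hlamH hlamE hpE hpE1 hp0).hard_mul_lt .easy))
  have hc0 : Tendsto c (𝓝[>] 0) (𝓝 0) := by
    have h := hratio.mul hpq
    rw [mul_zero] at h
    refine h.congr' ?_
    filter_upwards [eventually_mem_Ioo] with p hp0
    have := hp0.1.ne'
    field_simp
  have hpc : Tendsto (fun p => p * p / c p) (𝓝[>] 0) (𝓝 0) := by
    have h := (hp.div_const pE).div hratio one_ne_zero
    rw [zero_div, zero_div] at h
    refine h.congr' ?_
    filter_upwards [eventually_mem_Ioo] with p hp0
    have h1 := hp0.1.ne'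
    have h2 := (hcpos p hp0).ne'
    simp only [Pi.div_apply]
    field_simp
  have hdev : Tendsto (fun p => deviation (π p) (c p) x₀) (𝓝[>] 0) (𝓝 0) := by
    refine tendsto_zero_of_coercive (ε := fun p =>
      c p / 2 * (lamH + lamE) +
        (2 * lamH * x₀ * (pE * p) + 2 * lamE * c p +
          lamH * (2 * (1 + x₀) * (pE * p)) + (lamH + lamE) * ((4 + 2 * x₀) * c p)) *
            (1 / 2 + 2 / (pE * pE)) +
        2 * lamH * x₀ * (p * p / c p) * (x₀ + 1)) ?_ ?_ fun δ hδ => ?_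
    · filter_upwards [eventually_mem_Ioo] with p hp0 using deviation_nonneg (hπ p hp0) _ _
    · have h := (((hc0.div_const 2).mul_const (lamH + lamE)).add
        ((((((hp.const_mul pE).const_mul (2 * lamH * x₀)).add (hc0.const_mul (2 * lamE))).add
          (((hp.const_mul pE).const_mul (2 * (1 + x₀))).const_mul lamH)).add
          ((hc0.const_mul (4 + 2 * x₀)).const_mul (lamH + lamE))).mul_const
            (1 / 2 + 2 / (pE * pE)))).add
        ((hpc.const_mul (2 * lamH * x₀)).mul_const (x₀ + 1))
      simpa using h
    · obtain ⟨k, hk, hcoer⟩ := (restoringEasy_strictMono lamH hlamE).exists_coercive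
        (restoringEasy_eq_zero hlamH hlt) hδ
      refine ⟨k, hk, ?_⟩
      filter_upwards [eventually_mem_Ioo] with p hp0
      have hM := admissible_mk hlamH hlamE hpE hpE1 hp0
      have h := deviation_easy_le hM hlt (hπ p hp0) (c := c p) rfl hx₀0 hcoer
      simp only [Market.totalRate] at h
      have hc1 := hcpos p hp0
      have hppos := hp0.1
      set d := deviation (π p) (c p) x₀ with hd
      have hd0 : 0 ≤ d := deviation_nonneg (hπ p hp0) (c p) x₀
      set A := c p / 2 * (lamH + lamE) +
        (2 * lamH * x₀ * (pE * p) + 2 * lamE * c p +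
          lamH * (2 * (1 + x₀) * (pE * p)) + (lamH + lamE) * ((4 + 2 * x₀) * c p)) *
            (1 / 2 + 2 / (pE * pE)) with hA
      set D := 2 * lamH * x₀ * (p * p / c p) with hD
      have hA0 : 0 ≤ A := by positivity
      have hD0 : 0 ≤ D := by positivity
      have h1 := mul_nonneg hA0 hd0
      have h2 := mul_nonneg (mul_nonneg hD0 hx₀0) hd0
      linarith
  have hmean : Tendsto (fun p => c p * meanHard (π p)) (𝓝[>] 0) (𝓝 x₀) := by
    rw [tendsto_iff_norm_sub_tendsto_zero]
    refine squeeze_zero' (Eventually.of_forall fun p => norm_nonneg _) ?_ hdev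
    filter_upwards [eventually_mem_Ioo] with p hp0
    exact (hπ p hp0).abs_meanHard_sub_le (admissible_mk hlamH hlamE hpE hpE1 hp0) _ _
  have h := (hmean.div hratio one_ne_zero).div_const pE
  rw [div_one] at h
  refine h.congr' ?_
  filter_upwards [eventually_mem_Ioo] with p hp0
  have h1 := hp0.1.ne'
  have h2 := (hcpos p hp0).ne'
  simp only [Pi.div_apply]
  field_simp

end Limits

lemma IsSteadyState.toReal_avgWaitH {M : Market} (hM : M.Admissible) {π : ℕ × ℕ → ℝ}
    (hπ : IsSteadyState M π) : (avgWaitH M π).toReal = meanHard π / M.lamH := by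
  rw [hπ.avgWaitH_eq hM, ENNReal.toReal_ofReal]
  exact div_nonneg (tsum_nonneg fun s => mul_nonneg (hπ.nonneg s) (Nat.cast_nonneg _))
    hM.lamH_pos.le

end

theorem theorem2 (lamH lamE pE : ℝ) (hlamH : 0 < lamH) (hlamE : 0 < lamE)
    (hpE : 0 < pE) (hpE1 : pE ≤ 1) :
    (∀ pH ∈ Set.Ioo (0 : ℝ) 1, ∃! π : ℕ × ℕ → ℝ, IsSteadyState ⟨lamH, lamE, pH, pE⟩ π) ∧
    ∀ π : ℝ → ℕ × ℕ → ℝ,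
      (∀ pH ∈ Set.Ioo (0 : ℝ) 1, IsSteadyState ⟨lamH, lamE, pH, pE⟩ (π pH)) →
      (∀ pH ∈ Set.Ioo (0 : ℝ) 1, avgWaitH ⟨lamH, lamE, pH, pE⟩ (π pH) ≠ ⊤) ∧
      (lamH < lamE →
        ∃ L : ℝ,
          Tendsto (fun pH : ℝ => pH * (avgWaitH ⟨lamH, lamE, pH, pE⟩ (π pH)).toReal)
            (𝓝[>] 0) (𝓝 L) ∧
          Real.log (lamE / (lamE - lamH)) / (pE * lamH) ≤ L ∧
          L ≤ Real.log (2 * lamE / (lamE - lamH)) / (pE * lamH)) ∧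
      (lamE < lamH →
        Tendsto (fun pH : ℝ => pH ^ 2 * (avgWaitH ⟨lamH, lamE, pH, pE⟩ (π pH)).toReal)
          (𝓝[>] 0) (𝓝 (Real.log (2 * lamH / (lamH + lamE)) / lamH))) := by
  have hM := fun pH (hpH : pH ∈ Set.Ioo (0 : ℝ) 1) => admissible_mk hlamH hlamE hpE hpE1 hpH
  refine ⟨fun pH hpH => existsUnique_steadyState (hM pH hpH), fun π hπ => ⟨fun pH hpH => ?_,
    fun hlt => ?_, fun hlt => ?_⟩⟩
  · rw [(hπ pH hpH).avgWaitH_eq (hM pH hpH)]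
    exact ENNReal.ofReal_ne_top
  · have hd : 0 < lamE - lamH := sub_pos.2 hlt
    have hc : 0 < pE * lamH := mul_pos hpE hlamH
    refine ⟨Real.log ((lamE + lamH) / (lamE - lamH)) / (pE * lamH), ?_, ?_, ?_⟩
    · rw [← div_div]
      refine ((tendsto_meanHard_of_lt hlamH hpE hpE1 hlt hπ).div_const lamH).congr' ?_
      filter_upwards [eventually_mem_Ioo] with p hp
      rw [(hπ p hp).toReal_avgWaitH (hM p hp), mul_div_assoc]
    · refine div_le_div_of_nonneg_right (Real.log_le_log (by positivity) ?_) hc.le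
      exact div_le_div_of_nonneg_right (by linarith) hd.le
    · refine div_le_div_of_nonneg_right (Real.log_le_log (by positivity) ?_) hc.le
      exact div_le_div_of_nonneg_right (by linarith) hd.le
  · refine ((tendsto_meanHard_of_gt hlamE hpE hpE1 hlt hπ).div_const lamH).congr' ?_
    filter_upwards [eventually_mem_Ioo] with p hp
    rw [(hπ p hp).toReal_avgWaitH (hM p hp), mul_div_assoc]
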